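/- Let $d,k,l\in\mathbb{N}$, let $\Theta\subset\mathbb{R}^l$ be a nonempty compact set, let $T>0$, $1<p<\infty$, and $\mathcal{U}:=L^p([0,T],\mathbb{R}^k)$; $|\cdot|$ denotes the Euclidean norm. Let $F_0,F_1,\dots,F_k:\mathbb{R}^d\times\Theta\to\mathbb{R}^d$, $x_0:\Theta\to\mathbb{R}^d$, $a:\mathbb{R}^d\times\Theta\to[0,+\infty)$ and $f:[0,T]\times\mathbb{R}^k\to\mathbb{R}$ satisfy the following. 1. There is $L>0$ such that for all $(x_1,\theta_1),(x_2,\theta_2)\in\mathbb{R}^d\times\Theta$ $$\sup_{i=0,\dots,k}|F_i(x_1,\theta_1)-F_i(x_2,\theta_2)|\le L\big(|x_1-x_2|+|x_1+x_2|\,|\theta_1-\theta_2|\big).$$ 2. $x_0$ is continuous. 3. $a$ is continuous and nonnegative. 4. (i) $f(\cdot,v)$ is measurable for every $v\in\mathbb{R}^k$; (ii) $f(t,\cdot)$ is continuous and convex for a.e. $t\in[0,T]$; (iii) there are $c\in L^1([0,T],[0,+\infty))$ and $C>0$ such that $f(t,v)\ge C|v|^p-c(t)$ for a.e. $t\in[0,T]$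 and every $v\in\mathbb{R}^k$; (iv) there are $v'\in\mathbb{R}^k$ and $c'\in L^1([0,T],[0,+\infty))$ such that $|f(t,v')|\le c'(t)$ for a.e. $t\in[0,T]$. For $u\in\mathcal{U}$ and $\theta\in\Theta$ let $X_u(\cdot,\theta):[0,T]\to\mathbb{R}^d$ be the absolutely continuous solution of $$\dot x(t)=F_0(x(t),\theta)+\sum_{i=1}^k u_i(t)F_i(x(t),\theta)\ \text{ for a.e. } t\in[0,T],\qquad x(0)=x_0(\theta),$$ and define $$\mathcal{J}(u):=\max_{\theta\in\Theta}a(X_u(T,\theta),\theta)+\int_0^T f(t,u(t))\,dt .$$ Then $\mathcal{J}:\mathcal{U}\to\mathbb{R}\cup\{+\infty\}$ is well defined (for every $u\in\mathcal{U}$ the solution $X_u(\cdot,\theta)$ exists and is unique on $[0,T]$ for every $\theta\in\Theta$, the maximum over $\Theta$ is attained, $t\mapsto f(t,u(t))$ is measurable and its negative part is integrable on $[0,T]$), and $\mathcal{J}$ attains its minimum with a finite value: there exists $\hat u\in\mathcal{U}$ such that $$\mathcal{J}(\hat u)=\inf_{u\in\mathcal{U}}\mathcal{J}(u)\in\mathbb{R}.$$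 -/

import Mathlib

open MeasureTheory Set
open scoped ENNReal

/-- The Euclidean space `ℝⁿ`. -/
abbrev E (n : ℕ) : Type := EuclideanSpace ℝ (Fin n)

/-- The control space `L^p([0,T], ℝᵏ)`. -/
abbrev ControlSpace (T p : ℝ) (k : ℕ) : Type :=
  Lp (E k) (ENNReal.ofReal p) (volume.restrict (Icc (0 : ℝ) T))

/-- `x` is the (Carathéodory) solution on `[0,T]` of the system with parameter `θ`:
`x` is absolutely continuous on `[0,T]`, `x(0) = x₀(θ)`, and
`x'(t) = F₀(x(t),θ) + ∑ᵢ uᵢ(t) Fᵢ(x(t),θ)` for almost every `t ∈ [0,T]`. -/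
structure IsTrajectory {d k l : ℕ} {Θ : Set (E l)} (T : ℝ)
    (F₀ : E d → Θ → E d) (F : Fin k → E d → Θ → E d) (x₀ : Θ → E d)
    (u : ℝ → E k) (θ : Θ) (x : ℝ → E d) : Prop where
  absolutelyContinuous : AbsolutelyContinuousOnInterval x 0 T
  initial : x 0 = x₀ θ
  ode : ∀ᵐ t ∂(volume.restrict (Icc (0 : ℝ) T)),
    HasDerivAt x (F₀ (x t) θ + ∑ i, u t i • F i (x t) θ) t

/-- The evolution `X_u(t,θ)` of the ensemble: `X_u(·,θ)` is a solution of the Cauchy problem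
with control `u` and parameter `θ` (picked by choice; on `[0,T]` there is only one). -/
noncomputable def evolution {d k l : ℕ} {Θ : Set (E l)} (T : ℝ)
    (F₀ : E d → Θ → E d) (F : Fin k → E d → Θ → E d) (x₀ : Θ → E d)
    (u : ℝ → E k) (t : ℝ) (θ : Θ) : E d :=
  Classical.epsilon (fun x : ℝ → E d => IsTrajectory T F₀ F x₀ u θ x) t

/-- The integral over `[0,T]` with values in `[-∞,∞]`: integral of the positive part minus
integral of the negative part. -/
noncomputable def extIntegral (T : ℝ) (g : ℝ → ℝ) : EReal :=
  ((∫⁻ t in Icc (0 : ℝ) T, ENNReal.ofReal (g t) : ℝ≥0∞) : EReal) -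
    ((∫⁻ t in Icc (0 : ℝ) T, ENNReal.ofReal (-g t) : ℝ≥0∞) : EReal)

/-- The minimax functional
`J(u) = max_{θ ∈ Θ} a(X_u(T,θ),θ) + ∫₀ᵀ f(t,u(t)) dt`. -/
noncomputable def minimaxCost {d k l : ℕ} {Θ : Set (E l)} {p : ℝ} (T : ℝ)
    (F₀ : E d → Θ → E d) (F : Fin k → E d → Θ → E d) (x₀ : Θ → E d)
    (a : E d → Θ → ℝ) (f : ℝ → E k → ℝ) (u : ControlSpace T p k) : EReal :=
  (⨆ θ : Θ, ((a (evolution T F₀ F x₀ u T θ) θ : ℝ) : EReal)) +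
    extIntegral T (fun t => f t (u t))


/-!
Minimising controls are bounded in `L^p`, so by Hölder's inequality their primitives are
equi-Hölder and, by Arzelà–Ascoli, converge uniformly along a subsequence. Forward convex
combinations of the same controls can be chosen to converge almost everywhere, as in Komlós'
theorem: take almost-minimisers of the strictly convex functional `∫ √(1 + |v|²)` on the convex
hulls of the tails of the sequence. Uniform integrability identifies the limit of the primitives
with the primitive of the almost everywhere limit `w`, and convexity of the integrand together with
Fatou's lemma makes the running cost of `w` at most the limit of the running costs.

The trajectories depend on the control only through its primitive, in a continuous way: integrating
by parts, `∫ (uₙ - w) • Fᵢ(X_w)` is small uniformly in time when the primitives of `uₙ` are close to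
those of `w`, because `Fᵢ(X_w)` is absolutely continuous, and Gronwall's lemma with rate
`L (1 + k |uₙ|)` turns this into uniform convergence of `X_{uₙ}` to `X_w`. No compactness of the
controls in norm is needed, and the terminal cost passes to the limit for each parameter.
-/

section AbsolutelyContinuous

variable {X Y V : Type*} [PseudoMetricSpace X] [PseudoMetricSpace Y] [NormedAddCommGroup V]
  {a b t : ℝ}

theorem absolutelyContinuousOnInterval_of_dist_le_mul {f : ℝ → X} {g : ℝ → Y} {C : ℝ}
    (hg : AbsolutelyContinuousOnInterval g a b)
    (hfg : ∀ s ∈ uIcc a b, ∀ t ∈ uIcc a b, dist (f s) (f t) ≤ C * dist (g s) (g t)) :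
    AbsolutelyContinuousOnInterval f a b := by
  rw [absolutelyContinuousOnInterval_iff] at hg ⊢
  intro ε hε
  obtain ⟨δ, hδ, h⟩ := hg (ε / (|C| + 1)) (by positivity)
  refine ⟨δ, hδ, fun I hI hlen => ?_⟩
  calc ∑ i ∈ Finset.range I.1, dist (f (I.2 i).1) (f (I.2 i).2)
      ≤ ∑ i ∈ Finset.range I.1, (|C| + 1) * dist (g (I.2 i).1) (g (I.2 i).2) := by
        refine Finset.sum_le_sum fun i hi => (hfg _ (hI.1 i hi).1 _ (hI.1 i hi).2).trans ?_
        exact mul_le_mul_of_nonneg_right (by linarith [le_abs_self C]) dist_nonneg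
    _ = (|C| + 1) * ∑ i ∈ Finset.range I.1, dist (g (I.2 i).1) (g (I.2 i).2) := by
        rw [Finset.mul_sum]
    _ < (|C| + 1) * (ε / (|C| + 1)) :=
        mul_lt_mul_of_pos_left (h I hI hlen) (by positivity)
    _ = ε := by field_simp

theorem intervalIntegrable_of_mem_Icc {f : ℝ → V} (hf : IntervalIntegrable f volume a b)
    (ht : t ∈ Icc a b) : IntervalIntegrable f volume a t :=
  hf.mono_set (uIcc_subset_uIcc_left (Icc_subset_uIcc ht))

variable [NormedSpace ℝ V]

theorem absolutelyContinuousOnInterval_integral {f : ℝ → V}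
    (hf : IntervalIntegrable f volume a b) :
    AbsolutelyContinuousOnInterval (fun t => ∫ s in a..t, f s) a b := by
  refine absolutelyContinuousOnInterval_of_dist_le_mul (C := 1)
    (hf.norm.absolutelyContinuousOnInterval_intervalIntegral (c := a) left_mem_uIcc)
    fun s hs t ht => ?_
  have hi : ∀ {c}, c ∈ uIcc a b → IntervalIntegrable f volume a c := fun hc =>
    hf.mono_set (uIcc_subset_uIcc_left hc)
  rw [one_mul, dist_comm, dist_comm (∫ v in a..s, ‖f v‖), dist_eq_norm, Real.dist_eq,
    intervalIntegral.integral_interval_sub_left (hi ht) (hi hs),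
    intervalIntegral.integral_interval_sub_left (hi ht).norm (hi hs).norm]
  exact intervalIntegral.norm_integral_le_abs_integral_norm

theorem continuousOn_integral_Icc {f : ℝ → V} (hf : IntervalIntegrable f volume a b) :
    ContinuousOn (fun t => ∫ s in a..t, f s) (Icc a b) :=
  (absolutelyContinuousOnInterval_integral hf).continuousOn.mono Icc_subset_uIcc

theorem integral_le_integral_of_mem_Icc {m : ℝ → ℝ} (hm : IntervalIntegrable m volume a b)
    (hm0 : ∀ s, 0 ≤ m s) (ht : t ∈ Icc a b) : ∫ s in a..t, m s ≤ ∫ s in a..b, m s :=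
  intervalIntegral.integral_mono_interval le_rfl ht.1 ht.2 (Filter.Eventually.of_forall hm0) hm

theorem eq_add_integral_of_ae_hasDerivAt [CompleteSpace V] {x x' : ℝ → V}
    (hx : AbsolutelyContinuousOnInterval x a b) (hx' : IntervalIntegrable x' volume a b)
    (hderiv : ∀ᵐ t, t ∈ uIcc a b → HasDerivAt x (x' t) t) (ht : t ∈ uIcc a b) :
    x t = x a + ∫ s in a..t, x' s := by
  have hsub := hx.sub (absolutelyContinuousOnInterval_integral hx')
  obtain ⟨C, hC⟩ := hsub.const_of_ae_hasDerivAt_zero (by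
      filter_upwards [hderiv, hx'.ae_hasDerivAt_integral] with t hxt hint ht
      simpa using (hxt ht).sub (hint ht a left_mem_uIcc))
  have hCt := hC t ht
  have hCa := hC a left_mem_uIcc
  simp only [Pi.sub_apply, intervalIntegral.integral_same, sub_zero] at hCt hCa
  rw [hCa, ← hCt]
  abel

theorem integral_mul_deriv_comp_primitive {m g g' : ℝ → ℝ} (hm : IntervalIntegrable m volume a b)
    (hg : ∀ r, HasDerivAt g (g' r) r) (hg' : Continuous g') :
    IntervalIntegrable (fun s => m s * g' (∫ r in a..s, m r)) volume a b ∧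
      ∫ s in a..b, m s * g' (∫ r in a..s, m r) = g (∫ r in a..b, m r) - g 0 := by
  have hM := absolutelyContinuousOnInterval_integral hm
  have hint : IntervalIntegrable (fun s => m s * g' (∫ r in a..s, m r)) volume a b :=
    hm.mul_continuousOn (hg'.comp_continuousOn hM.continuousOn)
  refine ⟨hint, ?_⟩
  obtain ⟨B, hB⟩ := hM.exists_bound
  have hgC : ContDiff ℝ 1 g := contDiff_one_iff_deriv.2
    ⟨fun r => (hg r).differentiableAt, by rwa [funext fun r => (hg r).deriv]⟩
  obtain ⟨K, hK⟩ := hgC.contDiffOn.exists_lipschitzOnWith (s := Icc (-B) B) one_ne_zero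
    (convex_Icc _ _) isCompact_Icc
  have hmem : ∀ s ∈ uIcc a b, ∫ r in a..s, m r ∈ Icc (-B) B := fun s hs => abs_le.1 (hB s hs)
  have hgM : AbsolutelyContinuousOnInterval (fun s => g (∫ r in a..s, m r)) a b :=
    absolutelyContinuousOnInterval_of_dist_le_mul hM fun s hs s' hs' =>
      hK.dist_le_mul _ (hmem s hs) _ (hmem s' hs')
  have hFTC := eq_add_integral_of_ae_hasDerivAt hgM hint (by
    filter_upwards [hm.ae_hasDerivAt_integral] with s hs hsab
    rw [mul_comm]
    exact (hg _).comp s (hs hsab a left_mem_uIcc)) right_mem_uIcc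
  rw [hFTC, intervalIntegral.integral_same, add_sub_cancel_left]

theorem le_mul_exp_integral_of_le_add_integral {m φ : ℝ → ℝ} {A : ℝ}
    (hm : IntervalIntegrable m volume a b) (hm0 : ∀ s, 0 ≤ m s) (hφ : ContinuousOn φ (Icc a b))
    (h : ∀ t ∈ Icc a b, φ t ≤ A + ∫ s in a..t, m s * φ s) (ht : t ∈ Icc a b) :
    φ t ≤ A * Real.exp (∫ s in a..t, m s) := by
  have hcont : ContinuousOn (fun t => φ t * Real.exp (-∫ s in a..t, m s)) (Icc a b) :=
    hφ.mul (continuousOn_integral_Icc hm).neg.rexp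
  -- With `B` the maximum of `φ exp(-∫ m)`, inserting `φ ≤ B exp(∫ m)` in the hypothesis at a
  -- maximum point gives `B ≤ A`.
  obtain ⟨τ, hτ, hmax⟩ := isCompact_Icc.exists_isMaxOn ⟨t, ht⟩ hcont
  set B := φ τ * Real.exp (-∫ s in a..τ, m s)
  have hcancel : ∀ s, φ s * Real.exp (-∫ r in a..s, m r) * Real.exp (∫ r in a..s, m r) = φ s :=
    fun s => by rw [mul_assoc, ← Real.exp_add, neg_add_cancel, Real.exp_zero, mul_one]
  have hle : ∀ s ∈ Icc a b, φ s ≤ B * Real.exp (∫ r in a..s, m r) := fun s hs =>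
    (hcancel s).ge.trans (mul_le_mul_of_nonneg_right (hmax hs) (Real.exp_pos _).le)
  have hmτ := intervalIntegrable_of_mem_Icc hm hτ
  obtain ⟨hint, hchange⟩ := integral_mul_deriv_comp_primitive (g := fun r => B * Real.exp r)
    hmτ (fun r => (Real.hasDerivAt_exp r).const_mul B) (by fun_prop)
  have hmono : ∫ s in a..τ, m s * φ s ≤ ∫ s in a..τ, m s * (B * Real.exp (∫ r in a..s, m r)) := by
    refine intervalIntegral.integral_mono_on hτ.1 ?_ hint fun s hs =>
      mul_le_mul_of_nonneg_left (hle s ⟨hs.1, hs.2.trans hτ.2⟩) (hm0 s)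
    refine hmτ.mul_continuousOn (hφ.mono ?_)
    rw [uIcc_of_le hτ.1]
    exact Icc_subset_Icc_right hτ.2
  have hBA : B ≤ A := by
    have hτ_le := h τ hτ
    have hτ_eq : B * Real.exp (∫ s in a..τ, m s) = φ τ := hcancel τ
    rw [hchange, Real.exp_zero, mul_one] at hmono
    linarith
  exact (hle t ht).trans (mul_le_mul_of_nonneg_right hBA (Real.exp_pos _).le)

end AbsolutelyContinuous

section IntegralEquation

open Filter Topology

variable {V : Type*} [NormedAddCommGroup V] [NormedSpace ℝ V] {a b t : ℝ} {m : ℝ → ℝ}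
  {h : ℝ → V → V} {x y : ℝ → V} {x₀ y₀ : V}

/-- A Carathéodory vector field on `[a,b]` with Lipschitz rate `m ∈ L¹`; measurability in time is
encoded by integrability along continuous curves. -/
structure IsCaratheodoryField (a b : ℝ) (m : ℝ → ℝ) (h : ℝ → V → V) : Prop where
  intervalIntegrable_rate : IntervalIntegrable m volume a b
  rate_nonneg : ∀ s, 0 ≤ m s
  norm_sub_le : ∀ s v w, ‖h s v - h s w‖ ≤ m s * ‖v - w‖
  intervalIntegrable_comp : ∀ z : ℝ → V, ContinuousOn z (Icc a b) →
    IntervalIntegrable (fun s => h s (z s)) volume a b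

/-- The integrated form `x(t) = x₀ + ∫ₐᵗ h(s,x(s)) ds` on `[a,b]` of the Cauchy problem
`x' = h(t,x)`, `x(a) = x₀`. -/
structure IsIntegralSolution (a b : ℝ) (h : ℝ → V → V) (x₀ : V) (x : ℝ → V) : Prop where
  continuousOn : ContinuousOn x (Icc a b)
  eq_add_integral : ∀ t ∈ Icc a b, x t = x₀ + ∫ s in a..t, h s (x s)

namespace IsCaratheodoryField

theorem isIntegralSolution_iff [CompleteSpace V] (hh : IsCaratheodoryField a b m h)
    (hab : a ≤ b) :
    IsIntegralSolution a b h x₀ x ↔ AbsolutelyContinuousOnInterval x a b ∧ x a = x₀ ∧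
      ∀ᵐ t ∂volume.restrict (Icc a b), HasDerivAt x (h t (x t)) t := by
  refine ⟨fun hx => ?_, fun ⟨hac, hxa, hderiv⟩ => ?_⟩
  · have hint := hh.intervalIntegrable_comp x hx.continuousOn
    refine ⟨?_, by simpa using hx.eq_add_integral a ⟨le_rfl, hab⟩, ?_⟩
    · refine absolutelyContinuousOnInterval_of_dist_le_mul (C := 1)
        (absolutelyContinuousOnInterval_integral hint) fun s hs t ht => ?_
      rw [uIcc_of_le hab] at hs ht
      rw [hx.eq_add_integral s hs, hx.eq_add_integral t ht, dist_add_left, one_mul]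
    · rw [← Measure.restrict_congr_set Ioo_ae_eq_Icc, ae_restrict_iff' measurableSet_Ioo]
      filter_upwards [hint.ae_hasDerivAt_integral] with t hderiv ht
      refine ((hderiv (Icc_subset_uIcc (Ioo_subset_Icc_self ht)) a left_mem_uIcc).const_add
        x₀).congr_of_eventuallyEq ?_
      filter_upwards [Ioo_mem_nhds ht.1 ht.2] with s hs
      exact hx.eq_add_integral s (Ioo_subset_Icc_self hs)
  · have hcont : ContinuousOn x (Icc a b) := hac.continuousOn.mono Icc_subset_uIcc
    refine ⟨hcont, fun t ht => ?_⟩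
    rw [← hxa]
    refine eq_add_integral_of_ae_hasDerivAt hac (hh.intervalIntegrable_comp x hcont) ?_
      (Icc_subset_uIcc ht)
    rwa [uIcc_of_le hab, ← ae_restrict_iff' measurableSet_Icc]

theorem norm_sub_le_mul_exp (hh : IsCaratheodoryField a b m h)
    (hx : IsIntegralSolution a b h x₀ x) (hy : ContinuousOn y (Icc a b)) {A : ℝ}
    (hA : ∀ t ∈ Icc a b, ‖(x₀ + ∫ s in a..t, h s (y s)) - y t‖ ≤ A) (ht : t ∈ Icc a b) :
    ‖x t - y t‖ ≤ A * Real.exp (∫ s in a..t, m s) := by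
  refine le_mul_exp_integral_of_le_add_integral (φ := fun t => ‖x t - y t‖)
    hh.intervalIntegrable_rate hh.rate_nonneg (hx.continuousOn.sub hy).norm (fun t ht => ?_) ht
  have hix := intervalIntegrable_of_mem_Icc (hh.intervalIntegrable_comp x hx.continuousOn) ht
  have hiy := intervalIntegrable_of_mem_Icc (hh.intervalIntegrable_comp y hy) ht
  have hsplit : x t - y t =
      ((x₀ + ∫ s in a..t, h s (y s)) - y t) + ∫ s in a..t, (h s (x s) - h s (y s)) := by
    rw [hx.eq_add_integral t ht, intervalIntegral.integral_sub hix hiy]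
    abel
  rw [hsplit]
  refine (norm_add_le _ _).trans (add_le_add (hA t ht) ?_)
  refine intervalIntegral.norm_integral_le_of_norm_le ht.1
    (Eventually.of_forall fun s _ => hh.norm_sub_le s _ _) ?_
  refine (intervalIntegrable_of_mem_Icc hh.intervalIntegrable_rate ht).mul_continuousOn
    ((hx.continuousOn.sub hy).norm.mono ?_)
  rw [uIcc_of_le ht.1]
  exact Icc_subset_Icc_right ht.2

theorem eqOn_of_isIntegralSolution (hh : IsCaratheodoryField a b m h)
    (hx : IsIntegralSolution a b h x₀ x) (hy : IsIntegralSolution a b h x₀ y) :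
    EqOn x y (Icc a b) := by
  intro t ht
  have hle := hh.norm_sub_le_mul_exp hx hy.continuousOn (A := 0)
    (fun s hs => by rw [← hy.eq_add_integral s hs, sub_self, norm_zero]) ht
  rwa [zero_mul, norm_le_zero_iff, sub_eq_zero] at hle

theorem tendstoUniformlyOn {ι : Type*} {l : Filter ι} {m : ι → ℝ → ℝ} {h : ι → ℝ → V → V}
    {h' : ℝ → V → V} {x : ι → ℝ → V} {x₀ : ι → V} {M : ℝ}
    (hh : ∀ i, IsCaratheodoryField a b (m i) (h i)) (hM : ∀ i, ∫ s in a..b, m i s ≤ M)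
    (hx : ∀ i, IsIntegralSolution a b (h i) (x₀ i) (x i)) (hy : IsIntegralSolution a b h' y₀ y)
    (hx₀ : Tendsto x₀ l (𝓝 y₀))
    (hlim : TendstoUniformlyOn (fun i t => ∫ s in a..t, h i s (y s))
      (fun t => ∫ s in a..t, h' s (y s)) l (Icc a b)) :
    TendstoUniformlyOn x y l (Icc a b) := by
  rw [Metric.tendstoUniformlyOn_iff] at hlim ⊢
  intro ε hε
  have hδ : 0 < ε * Real.exp (-M) / 4 := by positivity
  filter_upwards [hlim _ hδ, Metric.tendsto_nhds.1 hx₀ _ hδ] with i hint hinit t ht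
  have hdefect : ∀ s ∈ Icc a b,
      ‖(x₀ i + ∫ r in a..s, h i r (y r)) - y s‖ ≤ ε * Real.exp (-M) / 2 := by
    intro s hs
    rw [hy.eq_add_integral s hs, ← dist_eq_norm]
    refine (dist_add_add_le _ _ _ _).trans ?_
    linarith [hint s hs, dist_comm (∫ r in a..s, h' r (y r)) (∫ r in a..s, h i r (y r))]
  have hmM : ∫ s in a..t, m i s ≤ M := (integral_le_integral_of_mem_Icc
    (hh i).intervalIntegrable_rate (hh i).rate_nonneg ht).trans (hM i)
  rw [dist_comm, dist_eq_norm]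
  calc ‖x i t - y t‖ ≤ ε * Real.exp (-M) / 2 * Real.exp (∫ s in a..t, m i s) :=
        (hh i).norm_sub_le_mul_exp (hx i) hy.continuousOn hdefect ht
    _ ≤ ε * Real.exp (-M) / 2 * Real.exp M := by gcongr
    _ = ε / 2 := by rw [Real.exp_neg]; field_simp
    _ < ε := half_lt_self hε

/-- The Picard operator `z ↦ x₀ + ∫ₐ h(s,z(s)) ds` on `C([a,b],V)`. -/
noncomputable def picardMap (hh : IsCaratheodoryField a b m h) (hab : a ≤ b) (x₀ : V)
    (z : C(Icc a b, V)) : C(Icc a b, V) where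
  toFun t := x₀ + ∫ s in a..t, h s (IccExtend hab z s)
  continuous_toFun := continuous_const.add (continuousOn_integral_Icc
    (hh.intervalIntegrable_comp _ z.continuous.Icc_extend'.continuousOn)).domRestrict

theorem norm_iterate_picardMap_sub_le (hh : IsCaratheodoryField a b m h) (hab : a ≤ b)
    (y z : C(Icc a b, V)) (n : ℕ) (t : Icc a b) :
    ‖((hh.picardMap hab x₀)^[n] y) t - ((hh.picardMap hab x₀)^[n] z) t‖ ≤
      dist y z * ((∫ s in a..t, m s) ^ n / n.factorial) := by
  induction n generalizing t with
  | zero => simpa [dist_eq_norm] using (y - z).norm_coe_le_norm t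
  | succ n ih =>
    set Y := (hh.picardMap hab x₀)^[n] y
    set Z := (hh.picardMap hab x₀)^[n] z
    have hint : ∀ w : C(Icc a b, V),
        IntervalIntegrable (fun s => h s (IccExtend hab w s)) volume a t := fun w =>
      intervalIntegrable_of_mem_Icc
        (hh.intervalIntegrable_comp _ w.continuous.Icc_extend'.continuousOn) t.2
    have hpow : ∀ r : ℝ, HasDerivAt (fun r => dist y z * (r ^ (n + 1) / (n + 1).factorial))
        (dist y z * (r ^ n / n.factorial)) r := fun r => by
      refine ((hasDerivAt_pow (n + 1) r).div_const _ |>.const_mul _).congr_deriv ?_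
      rw [Nat.factorial_succ]
      push_cast
      field_simp
    obtain ⟨hintm, hchange⟩ := integral_mul_deriv_comp_primitive
      (intervalIntegrable_of_mem_Icc hh.intervalIntegrable_rate t.2) hpow (by fun_prop)
    rw [Function.iterate_succ_apply', Function.iterate_succ_apply']
    calc ‖hh.picardMap hab x₀ Y t - hh.picardMap hab x₀ Z t‖
        = ‖∫ s in a..(t : ℝ), (h s (IccExtend hab Y s) - h s (IccExtend hab Z s))‖ := by
          rw [intervalIntegral.integral_sub (hint Y) (hint Z)]
          exact congrArg norm (add_sub_add_left_eq_sub _ _ _)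
      _ ≤ ∫ s in a..(t : ℝ), m s * (dist y z * ((∫ r in a..s, m r) ^ n / n.factorial)) := by
          refine intervalIntegral.norm_integral_le_of_norm_le t.2.1 (Eventually.of_forall
            fun s hs => (hh.norm_sub_le s _ _).trans ?_) hintm
          have hs' : s ∈ Icc a b := ⟨hs.1.le, hs.2.trans t.2.2⟩
          rw [IccExtend_of_mem _ _ hs', IccExtend_of_mem _ _ hs']
          exact mul_le_mul_of_nonneg_left (ih ⟨s, hs'⟩) (hh.rate_nonneg s)
      _ = dist y z * ((∫ s in a..t, m s) ^ (n + 1) / (n + 1).factorial) := by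
          rw [hchange]; simp

theorem exists_contractingWith_iterate_picardMap (hh : IsCaratheodoryField a b m h)
    (hab : a ≤ b) (x₀ : V) :
    ∃ n : ℕ, ContractingWith (1 / 2) (hh.picardMap hab x₀)^[n] := by
  obtain ⟨n, hn⟩ := ((FloorSemiring.tendsto_pow_div_factorial_atTop
    (∫ s in a..b, m s)).eventually (gt_mem_nhds one_half_pos)).exists
  refine ⟨n, by norm_num, LipschitzWith.of_dist_le_mul fun y z => ?_⟩
  rw [ContinuousMap.dist_le (by positivity)]
  intro t
  have hm0 : 0 ≤ ∫ s in a..t, m s :=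
    intervalIntegral.integral_nonneg t.2.1 fun s _ => hh.rate_nonneg s
  rw [dist_eq_norm]
  calc _ ≤ dist y z * ((∫ s in a..t, m s) ^ n / n.factorial) :=
        hh.norm_iterate_picardMap_sub_le hab y z n t
    _ ≤ dist y z * ((∫ s in a..b, m s) ^ n / n.factorial) := by
        gcongr
        exact integral_le_integral_of_mem_Icc hh.intervalIntegrable_rate hh.rate_nonneg t.2
    _ ≤ dist y z * (1 / 2) := by gcongr
    _ = ((1 / 2 : NNReal) : ℝ) * dist y z := by rw [mul_comm]; norm_num

theorem exists_isIntegralSolution [CompleteSpace V] (hh : IsCaratheodoryField a b m h)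
    (hab : a ≤ b) (x₀ : V) : ∃ x, IsIntegralSolution a b h x₀ x := by
  obtain ⟨n, hn⟩ := hh.exists_contractingWith_iterate_picardMap hab x₀
  have hfix := hn.isFixedPt_fixedPoint_iterate
  set x := ContractingWith.fixedPoint (hh.picardMap hab x₀)^[n] hn
  refine ⟨IccExtend hab x, x.continuous.Icc_extend'.continuousOn, fun t ht => ?_⟩
  rw [IccExtend_of_mem _ _ ht]
  exact (DFunLike.congr_fun hfix ⟨t, ht⟩).symm

end IsCaratheodoryField

end IntegralEquation

section IntegrationByParts

open Filter Topology

variable {a b : ℝ} {ι κ : Type*} [Fintype ι] [Fintype κ]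

theorem euclideanSpace_norm_le_sum_abs (x : EuclideanSpace ℝ ι) : ‖x‖ ≤ ∑ j, |x j| := by
  rw [EuclideanSpace.norm_eq]
  refine Real.sqrt_le_iff.2 ⟨Finset.sum_nonneg fun j _ => abs_nonneg _, ?_⟩
  exact Finset.sum_sq_le_sq_sum_of_nonneg fun j _ => abs_nonneg _

theorem intervalIntegrable_apply {u : ℝ → EuclideanSpace ℝ κ}
    (hu : IntervalIntegrable u volume a b) (i : κ) :
    IntervalIntegrable (fun s => u s i) volume a b :=
  ⟨(EuclideanSpace.proj (𝕜 := ℝ) i).integrable_comp hu.1,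
    (EuclideanSpace.proj (𝕜 := ℝ) i).integrable_comp hu.2⟩

theorem intervalIntegral_apply {u : ℝ → EuclideanSpace ℝ κ}
    (hu : IntervalIntegrable u volume a b) (i : κ) :
    ∫ s in a..b, u s i = (∫ s in a..b, u s) i :=
  (EuclideanSpace.proj (𝕜 := ℝ) i : EuclideanSpace ℝ κ →L[ℝ] ℝ).intervalIntegral_comp_comm hu

theorem integral_mul_eq_sub_integral_deriv_mul_integral {w g : ℝ → ℝ}
    (hg : AbsolutelyContinuousOnInterval g a b) (hw : IntervalIntegrable w volume a b) :
    ∫ s in a..b, w s * g s =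
      (g b * ∫ s in a..b, w s) - ∫ s in a..b, deriv g s * ∫ r in a..s, w r := by
  have hderiv : ∫ s in a..b, w s * g s =
      ∫ s in a..b, g s * deriv (fun r => ∫ v in a..r, w v) s := by
    refine intervalIntegral.integral_congr_ae ?_
    filter_upwards [hw.ae_hasDerivAt_integral] with s hs hs'
    rw [(hs (uIoc_subset_uIcc hs') a left_mem_uIcc).deriv, mul_comm]
  rw [hderiv, hg.integral_mul_deriv_eq_deriv_mul (absolutelyContinuousOnInterval_integral hw),
    intervalIntegral.integral_same, mul_zero, sub_zero]

theorem exists_forall_abs_integral_mul_le {g : ℝ → ℝ} (hab : a ≤ b)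
    (hg : AbsolutelyContinuousOnInterval g a b) :
    ∃ C : ℝ, ∀ (w : ℝ → ℝ) (η : ℝ), IntervalIntegrable w volume a b →
      (∀ t ∈ Icc a b, |∫ s in a..t, w s| ≤ η) →
      ∀ t ∈ Icc a b, |∫ s in a..t, w s * g s| ≤ C * η := by
  obtain ⟨B, hB⟩ := hg.exists_bound
  have hD := hg.intervalIntegrable_deriv
  refine ⟨B + ∫ s in a..b, |deriv g s|, fun w η hw hη t ht => ?_⟩
  have hη0 : 0 ≤ η := (abs_nonneg _).trans (hη a ⟨le_rfl, hab⟩)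
  have hsub : uIcc a t ⊆ uIcc a b := uIcc_subset_uIcc_left (Icc_subset_uIcc ht)
  rw [integral_mul_eq_sub_integral_deriv_mul_integral (hg.mono hsub) (hw.mono_set hsub), add_mul]
  refine (abs_sub _ _).trans (add_le_add ?_ ?_)
  · rw [abs_mul]
    exact mul_le_mul (hB t (Icc_subset_uIcc ht)) (hη t ht) (abs_nonneg _)
      ((norm_nonneg _).trans (hB a left_mem_uIcc))
  · calc |∫ s in a..t, deriv g s * ∫ v in a..s, w v| ≤ ∫ s in a..t, |deriv g s| * η := by
          rw [← Real.norm_eq_abs]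
          refine intervalIntegral.norm_integral_le_of_norm_le ht.1
            (Eventually.of_forall fun s hs => ?_) ((hD.mono_set hsub).abs.mul_const η)
          rw [norm_mul]
          exact mul_le_mul_of_nonneg_left (hη s ⟨hs.1.le, hs.2.trans ht.2⟩) (norm_nonneg _)
      _ = (∫ s in a..t, |deriv g s|) * η := intervalIntegral.integral_mul_const _ _
      _ ≤ (∫ s in a..b, |deriv g s|) * η := mul_le_mul_of_nonneg_right
          (integral_le_integral_of_mem_Icc hD.abs (fun _ => abs_nonneg _) ht) hη0

theorem exists_forall_norm_integral_smul_le {g : ℝ → EuclideanSpace ℝ ι} (hab : a ≤ b)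
    (hg : AbsolutelyContinuousOnInterval g a b) :
    ∃ C : ℝ, ∀ (w : ℝ → ℝ) (η : ℝ), IntervalIntegrable w volume a b →
      (∀ t ∈ Icc a b, |∫ s in a..t, w s| ≤ η) →
      ∀ t ∈ Icc a b, ‖∫ s in a..t, w s • g s‖ ≤ C * η := by
  have hcoord : ∀ j, AbsolutelyContinuousOnInterval (fun t => g t j) a b := fun j =>
    absolutelyContinuousOnInterval_of_dist_le_mul hg fun s _ t _ =>
      (EuclideanSpace.proj (𝕜 := ℝ) j : EuclideanSpace ℝ ι →L[ℝ] ℝ).lipschitz.dist_le_mul _ _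
  choose C hC using fun j => exists_forall_abs_integral_mul_le hab (hcoord j)
  refine ⟨∑ j, C j, fun w η hw hη t ht => ?_⟩
  have hint : IntervalIntegrable (fun s => w s • g s) volume a t :=
    intervalIntegrable_of_mem_Icc (hw.smul_continuousOn hg.continuousOn) ht
  calc ‖∫ s in a..t, w s • g s‖ ≤ ∑ j, |(∫ s in a..t, w s • g s) j| :=
        euclideanSpace_norm_le_sum_abs _
    _ = ∑ j, |∫ s in a..t, w s * g s j| := Finset.sum_congr rfl fun j _ => congrArg abs
        (intervalIntegral_apply hint j).symm
    _ ≤ ∑ j, C j * η := Finset.sum_le_sum fun j _ => hC j w η hw hη t ht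
    _ = (∑ j, C j) * η := (Finset.sum_mul _ _ _).symm

theorem intervalIntegrable_sum_smul {V : Type*} [NormedAddCommGroup V] [NormedSpace ℝ V]
    {u : ℝ → EuclideanSpace ℝ κ} {g : κ → ℝ → V} (hu : IntervalIntegrable u volume a b)
    (hg : ∀ i, ContinuousOn (g i) (uIcc a b)) :
    IntervalIntegrable (fun s => ∑ i, u s i • g i s) volume a b := by
  simpa only [Finset.sum_fn] using IntervalIntegrable.sum (f := fun i s => u s i • g i s)
    Finset.univ fun i _ => (intervalIntegrable_apply hu i).smul_continuousOn (hg i)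

theorem tendstoUniformlyOn_integral_sum_smul {α : Type*} {l : Filter α}
    {u : α → ℝ → EuclideanSpace ℝ κ} {w : ℝ → EuclideanSpace ℝ κ}
    {g : κ → ℝ → EuclideanSpace ℝ ι} (hab : a ≤ b)
    (hu : ∀ n, IntervalIntegrable (u n) volume a b) (hw : IntervalIntegrable w volume a b)
    (hg : ∀ i, AbsolutelyContinuousOnInterval (g i) a b)
    (hlim : TendstoUniformlyOn (fun n t => ∫ s in a..t, u n s) (fun t => ∫ s in a..t, w s) l
      (Icc a b)) :
    TendstoUniformlyOn (fun n t => ∫ s in a..t, ∑ i, u n s i • g i s)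
      (fun t => ∫ s in a..t, ∑ i, w s i • g i s) l (Icc a b) := by
  choose C hC using fun i => exists_forall_norm_integral_smul_le hab (hg i)
  rw [Metric.tendstoUniformlyOn_iff] at hlim ⊢
  intro ε hε
  filter_upwards [hlim (ε / (∑ i, |C i| + 1)) (by positivity)] with n hn t ht
  have hwi := fun i => intervalIntegrable_apply hw i
  have hui := fun i => intervalIntegrable_apply (hu n) i
  have hprim : ∀ i, ∀ r ∈ Icc a b, |∫ s in a..r, (w s i - u n s i)| ≤ ε / (∑ i, |C i| + 1) := by
    intro i r hr
    rw [intervalIntegral.integral_sub (intervalIntegrable_of_mem_Icc (hwi i) hr)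
      (intervalIntegrable_of_mem_Icc (hui i) hr),
      intervalIntegral_apply (intervalIntegrable_of_mem_Icc hw hr),
      intervalIntegral_apply (intervalIntegrable_of_mem_Icc (hu n) hr)]
    exact (PiLp.norm_apply_le ((∫ s in a..r, w s) - ∫ s in a..r, u n s) i).trans
      (dist_eq_norm (∫ s in a..r, w s) _ ▸ (hn r hr).le)
  have hdiff : (∫ s in a..t, ∑ i, w s i • g i s) - ∫ s in a..t, ∑ i, u n s i • g i s =
      ∑ i, ∫ s in a..t, (w s i - u n s i) • g i s := by
    have hint := fun v (hv : IntervalIntegrable v volume a b) => intervalIntegrable_of_mem_Icc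
      (intervalIntegrable_sum_smul hv fun i => (hg i).continuousOn) ht
    rw [← intervalIntegral.integral_sub (hint w hw) (hint (u n) (hu n)),
      ← intervalIntegral.integral_finsetSum fun i _ => intervalIntegrable_of_mem_Icc
        (((hwi i).sub (hui i)).smul_continuousOn (hg i).continuousOn) ht]
    simp only [sub_smul, Finset.sum_sub_distrib]
  rw [dist_eq_norm, hdiff]
  calc _ ≤ ∑ i, |C i| * (ε / (∑ i, |C i| + 1)) := norm_sum_le_of_le _ fun i _ =>
        (hC i _ _ ((hwi i).sub (hui i)) (hprim i) t ht).trans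
          (mul_le_mul_of_nonneg_right (le_abs_self _) (by positivity))
    _ < ε := by
        rw [← Finset.sum_mul, mul_div_assoc', div_lt_iff₀ (by positivity)]
        linarith

end IntegrationByParts

section ControlField

open Filter Topology

variable {V Θ κ : Type*} [NormedAddCommGroup V] [PseudoMetricSpace Θ] {a b L : ℝ}

/-- The Lipschitz condition imposed on the drift `F₀` and on the controlled fields `Fᵢ` of an
ensemble of control systems with parameters in `Θ`. -/
structure IsEnsembleLipschitz (L : ℝ) (F₀ : V → Θ → V) (F : κ → V → Θ → V) : Prop where
  nonneg : 0 ≤ L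
  drift : ∀ x₁ x₂ θ₁ θ₂,
    ‖F₀ x₁ θ₁ - F₀ x₂ θ₂‖ ≤ L * (‖x₁ - x₂‖ + ‖x₁ + x₂‖ * dist θ₁ θ₂)
  control : ∀ i x₁ x₂ θ₁ θ₂,
    ‖F i x₁ θ₁ - F i x₂ θ₂‖ ≤ L * (‖x₁ - x₂‖ + ‖x₁ + x₂‖ * dist θ₁ θ₂)

theorem IsEnsembleLipschitz.lipschitzWith_drift {F₀ : V → Θ → V} {F : κ → V → Θ → V}
    (hF : IsEnsembleLipschitz L F₀ F) (θ : Θ) :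
    LipschitzWith L.toNNReal fun x => F₀ x θ :=
  LipschitzWith.of_dist_le' fun x y => by simpa [dist_eq_norm] using hF.drift x y θ θ

theorem IsEnsembleLipschitz.lipschitzWith_control {F₀ : V → Θ → V} {F : κ → V → Θ → V}
    (hF : IsEnsembleLipschitz L F₀ F) (i : κ) (θ : Θ) :
    LipschitzWith L.toNNReal fun x => F i x θ :=
  LipschitzWith.of_dist_le' fun x y => by simpa [dist_eq_norm] using hF.control i x y θ θ

variable [NormedSpace ℝ V] [Fintype κ]

/-- The time-dependent vector field `F₀(·,θ) + ∑ᵢ uᵢ Fᵢ(·,θ)` driven by the control `u`. -/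
def controlField (F₀ : V → Θ → V) (F : κ → V → Θ → V) (u : ℝ → EuclideanSpace ℝ κ) (θ : Θ)
    (s : ℝ) (x : V) : V :=
  F₀ x θ + ∑ i, u s i • F i x θ

/-- The Lipschitz rate of `controlField`. -/
noncomputable def controlRate (L : ℝ) (u : ℝ → EuclideanSpace ℝ κ) (s : ℝ) : ℝ :=
  L * (1 + Fintype.card κ * ‖u s‖)

theorem integral_controlRate_le (hL : 0 ≤ L) {u : ℝ → EuclideanSpace ℝ κ} {K : ℝ}
    (hu : IntervalIntegrable u volume a b) (hK : ∫ s in a..b, ‖u s‖ ≤ K) :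
    ∫ s in a..b, controlRate L u s ≤ L * ((b - a) + Fintype.card κ * K) := by
  simp only [controlRate]
  rw [intervalIntegral.integral_const_mul, intervalIntegral.integral_add
    intervalIntegrable_const (hu.norm.const_mul _), intervalIntegral.integral_const_mul,
    intervalIntegral.integral_const, smul_eq_mul, mul_one]
  gcongr

namespace IsEnsembleLipschitz

variable {F₀ : V → Θ → V} {F : κ → V → Θ → V} {u : ℝ → EuclideanSpace ℝ κ}

theorem norm_controlField_sub_le (hF : IsEnsembleLipschitz L F₀ F) (u : ℝ → EuclideanSpace ℝ κ)
    (s : ℝ) (x₁ x₂ : V) (θ₁ θ₂ : Θ) :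
    ‖controlField F₀ F u θ₁ s x₁ - controlField F₀ F u θ₂ s x₂‖ ≤
      controlRate L u s * (‖x₁ - x₂‖ + ‖x₁ + x₂‖ * dist θ₁ θ₂) := by
  set R := ‖x₁ - x₂‖ + ‖x₁ + x₂‖ * dist θ₁ θ₂
  have hsplit : controlField F₀ F u θ₁ s x₁ - controlField F₀ F u θ₂ s x₂ =
      (F₀ x₁ θ₁ - F₀ x₂ θ₂) + ∑ i, u s i • (F i x₁ θ₁ - F i x₂ θ₂) := by
    simp only [controlField, smul_sub, Finset.sum_sub_distrib]
    abel
  rw [hsplit]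
  calc _ ≤ L * R + ∑ _i : κ, ‖u s‖ * (L * R) := by
        refine (norm_add_le _ _).trans (add_le_add (hF.drift _ _ _ _)
          (norm_sum_le_of_le _ fun i _ => ?_))
        rw [norm_smul]
        exact mul_le_mul (PiLp.norm_apply_le (u s) i) (hF.control _ _ _ _ _) (norm_nonneg _)
          (norm_nonneg _)
    _ = controlRate L u s * R := by
        rw [Finset.sum_const, Finset.card_univ, nsmul_eq_mul, controlRate]
        ring

theorem isCaratheodoryField (hF : IsEnsembleLipschitz L F₀ F) (hab : a ≤ b)
    (hu : IntervalIntegrable u volume a b) (θ : Θ) :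
    IsCaratheodoryField a b (controlRate L u) (controlField F₀ F u θ) where
  intervalIntegrable_rate := (intervalIntegrable_const.add (hu.norm.const_mul _)).const_mul L
  rate_nonneg s := mul_nonneg hF.nonneg (by positivity)
  norm_sub_le s v w := by simpa using hF.norm_controlField_sub_le u s v w θ θ
  intervalIntegrable_comp z hz := by
    rw [← uIcc_of_le hab] at hz
    exact ((hF.lipschitzWith_drift θ).continuous.comp_continuousOn hz).intervalIntegrable.add
      (intervalIntegrable_sum_smul hu fun i =>
        (hF.lipschitzWith_control i θ).continuous.comp_continuousOn hz)

theorem tendstoUniformlyOn_integral_controlField_param (hF : IsEnsembleLipschitz L F₀ F)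
    (hab : a ≤ b) (hu : IntervalIntegrable u volume a b) {y : ℝ → V}
    (hy : ContinuousOn y (Icc a b)) (θ₀ : Θ) :
    TendstoUniformlyOn (fun θ t => ∫ s in a..t, controlField F₀ F u θ s (y s))
      (fun t => ∫ s in a..t, controlField F₀ F u θ₀ s (y s)) (𝓝 θ₀) (Icc a b) := by
  obtain ⟨B, hB⟩ := isCompact_Icc.exists_bound_of_continuousOn hy
  have hB0 : 0 ≤ B := (norm_nonneg _).trans (hB a ⟨le_rfl, hab⟩)
  have hfield := hF.isCaratheodoryField hab hu
  have hm := (hfield θ₀).intervalIntegrable_rate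
  have hm0 := (hfield θ₀).rate_nonneg
  set M := ∫ s in a..b, controlRate L u s
  have hbound : ∀ θ, ∀ t ∈ Icc a b, dist (∫ s in a..t, controlField F₀ F u θ₀ s (y s))
      (∫ s in a..t, controlField F₀ F u θ s (y s)) ≤ M * (2 * B * dist θ₀ θ) := by
    intro θ t ht
    have hint := fun θ => intervalIntegrable_of_mem_Icc
      ((hfield θ).intervalIntegrable_comp y hy) ht
    rw [dist_eq_norm, ← intervalIntegral.integral_sub (hint θ₀) (hint θ)]
    calc _ ≤ ∫ s in a..t, controlRate L u s * (2 * B * dist θ₀ θ) := by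
          refine intervalIntegral.norm_integral_le_of_norm_le ht.1
            (Eventually.of_forall fun s hs => (hF.norm_controlField_sub_le u s _ _ _ _).trans ?_)
            ((intervalIntegrable_of_mem_Icc hm ht).mul_const _)
          rw [sub_self, norm_zero, zero_add, ← two_smul ℝ, norm_smul, Real.norm_two]
          gcongr
          exacts [hm0 s, hB s ⟨hs.1.le, hs.2.trans ht.2⟩]
      _ = (∫ s in a..t, controlRate L u s) * (2 * B * dist θ₀ θ) :=
          intervalIntegral.integral_mul_const _ _
      _ ≤ M * (2 * B * dist θ₀ θ) := by
          gcongr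
          exact integral_le_integral_of_mem_Icc hm hm0 ht
  rw [Metric.tendstoUniformlyOn_iff]
  intro ε hε
  have hcont : Continuous fun θ => M * (2 * B * dist θ₀ θ) := by fun_prop
  filter_upwards [hcont.continuousAt.eventually_lt continuousAt_const (by simpa using hε)]
    with θ hθ t ht
  exact (hbound θ t ht).trans_lt hθ

theorem tendstoUniformlyOn_integral_controlField_control {ι α : Type*} [Fintype ι] {l : Filter α}
    {F₀ : EuclideanSpace ℝ ι → Θ → EuclideanSpace ℝ ι}
    {F : κ → EuclideanSpace ℝ ι → Θ → EuclideanSpace ℝ ι} {u : α → ℝ → EuclideanSpace ℝ κ}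
    {w : ℝ → EuclideanSpace ℝ κ} {y : ℝ → EuclideanSpace ℝ ι} (hF : IsEnsembleLipschitz L F₀ F)
    (hab : a ≤ b) (hu : ∀ n, IntervalIntegrable (u n) volume a b)
    (hw : IntervalIntegrable w volume a b)
    (hlim : TendstoUniformlyOn (fun n t => ∫ s in a..t, u n s) (fun t => ∫ s in a..t, w s) l
      (Icc a b))
    (hy : AbsolutelyContinuousOnInterval y a b) (θ : Θ) :
    TendstoUniformlyOn (fun n t => ∫ s in a..t, controlField F₀ F (u n) θ s (y s))
      (fun t => ∫ s in a..t, controlField F₀ F w θ s (y s)) l (Icc a b) := by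
  have hFy : ∀ i, AbsolutelyContinuousOnInterval (fun s => F i (y s) θ) a b := fun i =>
    absolutelyContinuousOnInterval_of_dist_le_mul hy fun s _ t _ =>
      (hF.lipschitzWith_control i θ).dist_le_mul (y s) (y t)
  have hsplit : ∀ v, IntervalIntegrable v volume a b → ∀ t ∈ Icc a b,
      ∫ s in a..t, controlField F₀ F v θ s (y s) =
        (∫ s in a..t, F₀ (y s) θ) + ∫ s in a..t, ∑ i, v s i • F i (y s) θ := fun v hv t ht =>
    intervalIntegral.integral_add
      (intervalIntegrable_of_mem_Icc ((hF.lipschitzWith_drift θ).continuous.comp_continuousOn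
        hy.continuousOn).intervalIntegrable ht)
      (intervalIntegrable_of_mem_Icc
        (intervalIntegrable_sum_smul hv fun i => (hFy i).continuousOn) ht)
  have hsum := tendstoUniformlyOn_integral_sum_smul hab hu hw hFy hlim
  rw [Metric.tendstoUniformlyOn_iff] at hsum ⊢
  intro ε hε
  filter_upwards [hsum ε hε] with n hn t ht
  rw [hsplit w hw t ht, hsplit (u n) (hu n) t ht, dist_add_left]
  exact hn t ht

end IsEnsembleLipschitz

end ControlField

section Evolution

open Filter Topology

variable {d k l : ℕ} {Θ : Set (E l)} {T L : ℝ} {F₀ : E d → Θ → E d} {F : Fin k → E d → Θ → E d}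
  {x₀ : Θ → E d} {u : ℝ → E k}

theorem isTrajectory_iff_isIntegralSolution (hF : IsEnsembleLipschitz L F₀ F) (hT : 0 ≤ T)
    (hu : IntervalIntegrable u volume 0 T) {θ : Θ} {x : ℝ → E d} :
    IsTrajectory T F₀ F x₀ u θ x ↔
      IsIntegralSolution 0 T (controlField F₀ F u θ) (x₀ θ) x := by
  rw [(hF.isCaratheodoryField hT hu θ).isIntegralSolution_iff hT]
  exact ⟨fun h => ⟨h.1, h.2, h.3⟩, fun h => ⟨h.1, h.2.1, h.2.2⟩⟩

theorem IsTrajectory.eqOn (hF : IsEnsembleLipschitz L F₀ F) (hT : 0 ≤ T)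
    (hu : IntervalIntegrable u volume 0 T) {θ : Θ} {x y : ℝ → E d}
    (hx : IsTrajectory T F₀ F x₀ u θ x) (hy : IsTrajectory T F₀ F x₀ u θ y) :
    EqOn x y (Icc 0 T) :=
  (hF.isCaratheodoryField hT hu θ).eqOn_of_isIntegralSolution
    ((isTrajectory_iff_isIntegralSolution hF hT hu).1 hx)
    ((isTrajectory_iff_isIntegralSolution hF hT hu).1 hy)

namespace IsEnsembleLipschitz

theorem isTrajectory_evolution (hF : IsEnsembleLipschitz L F₀ F) (hT : 0 ≤ T)
    (hu : IntervalIntegrable u volume 0 T) (θ : Θ) :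
    IsTrajectory T F₀ F x₀ u θ (fun t => evolution T F₀ F x₀ u t θ) := by
  obtain ⟨x, hx⟩ := (hF.isCaratheodoryField hT hu θ).exists_isIntegralSolution hT (x₀ θ)
  exact Classical.epsilon_spec (p := IsTrajectory T F₀ F x₀ u θ)
    ⟨x, (isTrajectory_iff_isIntegralSolution hF hT hu).2 hx⟩

theorem isIntegralSolution_evolution (hF : IsEnsembleLipschitz L F₀ F) (hT : 0 ≤ T)
    (hu : IntervalIntegrable u volume 0 T) (θ : Θ) :
    IsIntegralSolution 0 T (controlField F₀ F u θ) (x₀ θ)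
      (fun t => evolution T F₀ F x₀ u t θ) :=
  (isTrajectory_iff_isIntegralSolution hF hT hu).1 (hF.isTrajectory_evolution hT hu θ)

theorem continuous_evolution (hF : IsEnsembleLipschitz L F₀ F) (hT : 0 ≤ T)
    (hu : IntervalIntegrable u volume 0 T) (hx₀ : Continuous x₀) {t : ℝ} (ht : t ∈ Icc 0 T) :
    Continuous fun θ => evolution T F₀ F x₀ u t θ := by
  have hsol := hF.isIntegralSolution_evolution hT hu (x₀ := x₀)
  refine continuous_iff_continuousAt.2 fun θ₀ => ?_
  exact (IsCaratheodoryField.tendstoUniformlyOn (hF.isCaratheodoryField hT hu)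
    (fun _ => le_rfl) hsol (hsol θ₀) hx₀.continuousAt
    (hF.tendstoUniformlyOn_integral_controlField_param hT hu
      (hsol θ₀).continuousOn θ₀)).tendsto_at ht

theorem tendstoUniformlyOn_evolution {ι : Type*} {f : Filter ι} {u : ι → ℝ → E k} {w : ℝ → E k}
    {K : ℝ} (hF : IsEnsembleLipschitz L F₀ F) (hT : 0 ≤ T)
    (hu : ∀ n, IntervalIntegrable (u n) volume 0 T) (hw : IntervalIntegrable w volume 0 T)
    (hK : ∀ n, ∫ s in 0..T, ‖u n s‖ ≤ K)
    (hlim : TendstoUniformlyOn (fun n t => ∫ s in 0..t, u n s) (fun t => ∫ s in 0..t, w s) f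
      (Icc 0 T)) (θ : Θ) :
    TendstoUniformlyOn (fun n t => evolution T F₀ F x₀ (u n) t θ)
      (fun t => evolution T F₀ F x₀ w t θ) f (Icc 0 T) :=
  IsCaratheodoryField.tendstoUniformlyOn (fun n => hF.isCaratheodoryField hT (hu n) θ)
    (fun n => integral_controlRate_le hF.nonneg (hu n) (hK n))
    (fun n => hF.isIntegralSolution_evolution hT (hu n) θ)
    (hF.isIntegralSolution_evolution hT hw θ) tendsto_const_nhds
    (hF.tendstoUniformlyOn_integral_controlField_control hT hu hw hlim
      (hF.isTrajectory_evolution hT hw θ).absolutelyContinuous θ)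

end IsEnsembleLipschitz

end Evolution

section Lp

variable {V : Type*} [NormedAddCommGroup V] {Ω : Type*} [MeasurableSpace Ω] {μ : Measure Ω}
  {p : ℝ≥0∞}

theorem setIntegral_norm_le_measureReal_rpow_mul_norm [Fact (1 ≤ p)] (f : Lp V p μ) {s : Set Ω}
    (hs : μ s ≠ ∞) : ∫ x in s, ‖f x‖ ∂μ ≤ μ.real s ^ (1 - 1 / p.toReal) * ‖f‖ := by
  have hf : AEStronglyMeasurable f (μ.restrict s) := (Lp.aestronglyMeasurable f).restrict
  have hexp : 0 ≤ 1 - 1 / p.toReal := by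
    rcases eq_or_ne p ∞ with rfl | hp
    · simp
    · have : 1 ≤ p.toReal := by simpa using ENNReal.toReal_mono hp (Fact.out : 1 ≤ p)
      exact sub_nonneg.2 (div_le_one_of_le₀ this (by linarith))
  have hHolder : eLpNorm f 1 (μ.restrict s) ≤ μ s ^ (1 - 1 / p.toReal) * eLpNorm f p μ := by
    have h := eLpNorm_le_eLpNorm_mul_rpow_measure_univ (Fact.out : 1 ≤ p) hf
    rw [Measure.restrict_apply_univ, ENNReal.toReal_one, div_one, mul_comm] at h
    exact h.trans (mul_le_mul_right (eLpNorm_mono_measure f Measure.restrict_le_self) _)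
  rw [integral_norm_eq_lintegral_enorm hf, ← eLpNorm_one_eq_lintegral_enorm, Lp.norm_def,
    Measure.real, ENNReal.toReal_rpow, ← ENNReal.toReal_mul]
  exact ENNReal.toReal_mono
    (ENNReal.mul_ne_top (ENNReal.rpow_ne_top_of_nonneg hexp hs) (Lp.eLpNorm_ne_top f)) hHolder

theorem coeFn_midpoint [NormedSpace ℝ V] [Fact (1 ≤ p)] (f g : Lp V p μ) :
    ⇑(midpoint ℝ f g) =ᵐ[μ] fun x => midpoint ℝ (f x) (g x) := by
  simp only [midpoint_eq_smul_add]
  filter_upwards [Lp.coeFn_smul (⅟2 : ℝ) (f + g), Lp.coeFn_add f g] with x hsmul hadd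
  rw [hsmul, Pi.smul_apply, hadd, Pi.add_apply]

end Lp

section Komlos

open Filter Topology

section JapaneseBracket

variable {V : Type*} [NormedAddCommGroup V]

/-- The Japanese bracket `⟨x⟩ = √(1 + ‖x‖²)`: a strictly convex function of linear growth. -/
noncomputable def japaneseBracket (x : V) : ℝ := √(1 + ‖x‖ ^ 2)

theorem japaneseBracket_pos (x : V) : 0 < japaneseBracket x := by
  unfold japaneseBracket; positivity

theorem japaneseBracket_sq (x : V) : japaneseBracket x ^ 2 = 1 + ‖x‖ ^ 2 :=
  Real.sq_sqrt (by positivity)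

theorem japaneseBracket_le_one_add_norm (x : V) : japaneseBracket x ≤ 1 + ‖x‖ :=
  Real.sqrt_le_iff.2 ⟨by positivity, by nlinarith [norm_nonneg x]⟩

theorem continuous_japaneseBracket : Continuous (japaneseBracket : V → ℝ) := by
  unfold japaneseBracket; fun_prop

variable [InnerProductSpace ℝ V]

/-- The midpoint convexity defect `⟨x⟩ + ⟨y⟩ - 2⟨(x + y)/2⟩` of the Japanese bracket; it controls
the distance of `x` and `y`. -/
noncomputable def bracketDefect (x y : V) : ℝ :=
  japaneseBracket x + japaneseBracket y - 2 * japaneseBracket (midpoint ℝ x y)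

theorem continuous_bracketDefect : Continuous (Function.uncurry (bracketDefect : V → V → ℝ)) := by
  have := continuous_japaneseBracket (V := V)
  simp only [Function.uncurry_def, bracketDefect, midpoint_eq_smul_add]
  fun_prop

theorem norm_sub_sq_le_japaneseBracket_mul_sq_sub (x y : V) :
    ‖x - y‖ ^ 2 ≤ (japaneseBracket x * japaneseBracket y) ^ 2 - (1 + inner ℝ x y) ^ 2 := by
  have hCS : inner ℝ x y ^ 2 ≤ ‖x‖ ^ 2 * ‖y‖ ^ 2 := by
    rw [← mul_pow, ← sq_abs]
    exact pow_le_pow_left₀ (abs_nonneg _) (abs_real_inner_le_norm x y) 2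
  rw [mul_pow, japaneseBracket_sq, japaneseBracket_sq, norm_sub_sq_real]
  linarith

theorem one_add_inner_le_japaneseBracket_mul (x y : V) :
    1 + inner ℝ x y ≤ japaneseBracket x * japaneseBracket y :=
  (le_abs_self _).trans <| abs_le_of_sq_le_sq
    (by linarith [norm_sub_sq_le_japaneseBracket_mul_sq_sub x y, sq_nonneg ‖x - y‖])
    (mul_pos (japaneseBracket_pos x) (japaneseBracket_pos y)).le

theorem bracketDefect_mul_add (x y : V) :
    bracketDefect x y * (japaneseBracket x + japaneseBracket y +
      2 * japaneseBracket (midpoint ℝ x y)) =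
      2 * (japaneseBracket x * japaneseBracket y - (1 + inner ℝ x y)) := by
  have hmid : ‖midpoint ℝ x y‖ ^ 2 = (‖x‖ ^ 2 + 2 * inner ℝ x y + ‖y‖ ^ 2) / 4 := by
    rw [midpoint_eq_smul_add, norm_smul, mul_pow, norm_add_sq_real]
    norm_num
    ring
  calc _ = japaneseBracket x ^ 2 + japaneseBracket y ^ 2 +
        2 * (japaneseBracket x * japaneseBracket y) -
        4 * japaneseBracket (midpoint ℝ x y) ^ 2 := by unfold bracketDefect; ring
    _ = _ := by
        simp only [japaneseBracket_sq, hmid]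
        ring

theorem bracketDefect_nonneg (x y : V) : 0 ≤ bracketDefect x y := by
  have hpos : 0 < japaneseBracket x + japaneseBracket y +
      2 * japaneseBracket (midpoint ℝ x y) := by
    linarith [japaneseBracket_pos x, japaneseBracket_pos y, japaneseBracket_pos (midpoint ℝ x y)]
  refine nonneg_of_mul_nonneg_left ?_ hpos
  rw [bracketDefect_mul_add]
  linarith [one_add_inner_le_japaneseBracket_mul x y]

theorem norm_sub_sq_le_bracketDefect_mul (x y : V) :
    ‖x - y‖ ^ 2 ≤ bracketDefect x y * (japaneseBracket x + japaneseBracket y) ^ 3 := by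
  have hX := japaneseBracket_pos x
  have hY := japaneseBracket_pos y
  have hD := bracketDefect_nonneg x y
  have hle := one_add_inner_le_japaneseBracket_mul x y
  have hmid : 2 * japaneseBracket (midpoint ℝ x y) ≤ japaneseBracket x + japaneseBracket y :=
    sub_nonneg.1 hD
  have hDmul := bracketDefect_mul_add x y
  have hsq := norm_sub_sq_le_japaneseBracket_mul_sq_sub x y
  set X := japaneseBracket x
  set Y := japaneseBracket y
  set c : ℝ := inner ℝ x y
  have hdiff : X * Y - (1 + c) ≤ bracketDefect x y * (X + Y) := by
    nlinarith [mul_le_mul_of_nonneg_left hmid hD]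
  have hsum : X * Y + (1 + c) ≤ (X + Y) ^ 2 := by nlinarith
  calc ‖x - y‖ ^ 2 ≤ (X * Y - (1 + c)) * (X * Y + (1 + c)) := by linarith
    _ ≤ (X * Y - (1 + c)) * (X + Y) ^ 2 := mul_le_mul_of_nonneg_left hsum (by linarith)
    _ ≤ bracketDefect x y * (X + Y) * (X + Y) ^ 2 := by gcongr
    _ = bracketDefect x y * (X + Y) ^ 3 := by ring

theorem norm_sub_le_sq_bracketDefect_add (x y : V) {ε : ℝ} (hε : 0 < ε) :
    ‖x - y‖ ≤
      (bracketDefect x y / ε ^ 3 + ε * (japaneseBracket x + japaneseBracket y)) ^ 2 := by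
  have hP : 0 ≤ bracketDefect x y / ε ^ 3 := div_nonneg (bracketDefect_nonneg x y) (by positivity)
  have hQ : 0 ≤ ε * (japaneseBracket x + japaneseBracket y) :=
    mul_nonneg hε.le (add_pos (japaneseBracket_pos x) (japaneseBracket_pos y)).le
  refine le_of_sq_le_sq ?_ (by positivity)
  calc ‖x - y‖ ^ 2 ≤ bracketDefect x y * (japaneseBracket x + japaneseBracket y) ^ 3 :=
        norm_sub_sq_le_bracketDefect_mul x y
    _ = bracketDefect x y / ε ^ 3 * (ε * (japaneseBracket x + japaneseBracket y)) ^ 3 := by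
        field_simp
    _ ≤ (bracketDefect x y / ε ^ 3 + ε * (japaneseBracket x + japaneseBracket y)) *
          (bracketDefect x y / ε ^ 3 + ε * (japaneseBracket x + japaneseBracket y)) ^ 3 := by
        gcongr <;> linarith
    _ = _ := by ring

theorem exists_tendsto_of_summable_bracketDefect_add [CompleteSpace V] {v : ℕ → V} {ε : ℕ → ℝ}
    (hε : ∀ n, 0 < ε n)
    (hsum : Summable fun n => bracketDefect (v n) (v (n + 1)) / ε n ^ 3 +
      ε n * (japaneseBracket (v n) + japaneseBracket (v (n + 1)))) :
    ∃ l, Tendsto v atTop (𝓝 l) := by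
  refine cauchySeq_tendsto_of_complete (cauchySeq_of_summable_dist ?_)
  refine Summable.of_norm_bounded_eventually_nat hsum ?_
  filter_upwards [hsum.tendsto_atTop_zero.eventually (gt_mem_nhds one_pos)] with n hn
  rw [Real.norm_of_nonneg dist_nonneg, dist_eq_norm]
  refine (norm_sub_le_sq_bracketDefect_add _ _ (hε n)).trans (pow_le_of_le_one ?_ hn.le two_ne_zero)
  have := bracketDefect_nonneg (v n) (v (n + 1))
  have := add_pos (japaneseBracket_pos (v n)) (japaneseBracket_pos (v (n + 1)))
  have := hε n
  positivity

end JapaneseBracket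

theorem exists_seq_mem_add_sub_two_mul_midpoint_le {W : Type*} [AddCommGroup W] [Module ℝ W]
    {A : ℕ → Set W} (hanti : Antitone A) (hconv : ∀ n, Convex ℝ (A n))
    (hne : ∀ n, (A n).Nonempty) {Ψ : W → ℝ} {m M : ℝ} (hm : ∀ v ∈ A 0, m ≤ Ψ v)
    (hM : ∀ v ∈ A 0, Ψ v ≤ M) {ε : ℕ → ℝ} (hε : ∀ n, 0 < ε n) (hεanti : Antitone ε) :
    ∃ v : ℕ → W, (∀ n, v n ∈ A n) ∧
      ∀ n, Ψ (v n) + Ψ (v (n + 1)) - 2 * Ψ (midpoint ℝ (v n) (v (n + 1))) ≤ ε n := by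
  -- The infima of `Ψ` over the sets `A n` increase to a limit `J`; far out, elements of `A n` that
  -- almost minimise `Ψ` have values close to `J`, and so do their midpoints.
  have hbdd (n : ℕ) : BddBelow (Ψ '' A n) :=
    ⟨m, forall_mem_image.2 fun v hv => hm v (hanti n.zero_le hv)⟩
  have hle {n : ℕ} {v : W} (hv : v ∈ A n) : sInf (Ψ '' A n) ≤ Ψ v :=
    csInf_le (hbdd n) (mem_image_of_mem Ψ hv)
  have hmono : Monotone fun n => sInf (Ψ '' A n) := fun i j hij =>
    csInf_le_csInf (hbdd i) ((hne j).image Ψ) (image_mono (hanti hij))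
  have hbddAbove : BddAbove (range fun n => sInf (Ψ '' A n)) := by
    refine ⟨M, forall_mem_range.2 fun n => ?_⟩
    obtain ⟨v, hv⟩ := hne n
    exact (hle hv).trans (hM v (hanti n.zero_le hv))
  have hlim := tendsto_atTop_ciSup hmono hbddAbove
  have hleJ := le_ciSup hbddAbove
  set J := ⨆ n, sInf (Ψ '' A n)
  obtain ⟨φ, hφ, hφJ⟩ := extraction_forall_of_eventually fun n =>
    hlim.eventually (lt_mem_nhds (show J - ε n / 4 < J by linarith [hε n]))
  have hex (n : ℕ) : ∃ v ∈ A (φ n), Ψ v < J + ε n / 4 := by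
    obtain ⟨_, ⟨v, hv, rfl⟩, hlt⟩ := exists_lt_of_csInf_lt ((hne (φ n)).image Ψ)
      (show sInf (Ψ '' A (φ n)) < J + ε n / 4 by linarith [hleJ (φ n), hε n])
    exact ⟨v, hv, hlt⟩
  choose v hvA hvJ using hex
  refine ⟨v, fun n => hanti (hφ.id_le n) (hvA n), fun n => ?_⟩
  have hmid : midpoint ℝ (v n) (v (n + 1)) ∈ A (φ n) :=
    (hconv _).midpoint_mem (hvA n) (hanti (hφ.monotone n.le_succ) (hvA (n + 1)))
  linarith [hle hmid, hφJ n, hvJ n, hvJ (n + 1), hεanti n.le_succ]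

variable {V : Type*} [NormedAddCommGroup V] {Ω : Type*} [MeasurableSpace Ω] {μ : Measure Ω}

theorem ae_summable_of_summable_integral {g : ℕ → Ω → ℝ} (hg : ∀ n, Integrable (g n) μ)
    (hg0 : ∀ n x, 0 ≤ g n x) {b : ℕ → ℝ} (hb : Summable b) (h : ∀ n, ∫ x, g n x ∂μ ≤ b n) :
    ∀ᵐ x ∂μ, Summable fun n => g n x := by
  have hnorm (n : ℕ) (x : Ω) : ‖g n x‖ = g n x := Real.norm_of_nonneg (hg0 n x)
  have hfin : ∑' n, eLpNorm (g n) 1 μ ≠ ∞ := by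
    refine ne_top_of_le_ne_top hb.tsum_ofReal_ne_top (ENNReal.tsum_le_tsum fun n => ?_)
    rw [eLpNorm_one_eq_lintegral_enorm, ← ofReal_integral_norm_eq_lintegral_enorm (hg n)]
    simpa only [hnorm] using ENNReal.ofReal_le_ofReal (h n)
  simpa only [hnorm] using
    summable_norm_of_tsum_eLpNorm_ne_top le_rfl (fun n => (hg n).aestronglyMeasurable) hfin

theorem integrable_japaneseBracket [IsFiniteMeasure μ] {v : Ω → V} (hv : Integrable v μ) :
    Integrable (fun x => japaneseBracket (v x)) μ :=
  ((integrable_const (1 : ℝ)).add hv.norm).mono'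
    (continuous_japaneseBracket.comp_aestronglyMeasurable hv.aestronglyMeasurable)
    (.of_forall fun x => by
      rw [Real.norm_of_nonneg (japaneseBracket_pos _).le]
      exact japaneseBracket_le_one_add_norm _)

theorem integral_japaneseBracket_le [IsFiniteMeasure μ] {v : Ω → V} (hv : Integrable v μ) :
    ∫ x, japaneseBracket (v x) ∂μ ≤ μ.real univ + ∫ x, ‖v x‖ ∂μ :=
  calc ∫ x, japaneseBracket (v x) ∂μ ≤ ∫ x, (1 + ‖v x‖) ∂μ :=
        integral_mono (integrable_japaneseBracket hv) ((integrable_const 1).add hv.norm)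
          fun x => japaneseBracket_le_one_add_norm _
    _ = μ.real univ + ∫ x, ‖v x‖ ∂μ := by
        rw [integral_add (integrable_const _) hv.norm]; simp

variable [InnerProductSpace ℝ V]

theorem integrable_bracketDefect [IsFiniteMeasure μ] {v w : Ω → V} (hv : Integrable v μ)
    (hw : Integrable w μ) : Integrable (fun x => bracketDefect (v x) (w x)) μ := by
  refine ((integrable_japaneseBracket hv).add (integrable_japaneseBracket hw)).mono'
    (continuous_bracketDefect.comp_aestronglyMeasurable₂ hv.aestronglyMeasurable
      hw.aestronglyMeasurable) (.of_forall fun x => ?_)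
  rw [Real.norm_of_nonneg (bracketDefect_nonneg _ _), bracketDefect, Pi.add_apply]
  linarith [japaneseBracket_pos (midpoint ℝ (v x) (w x))]

theorem ae_exists_tendsto_of_integral_bracketDefect_le [IsFiniteMeasure μ] [CompleteSpace V]
    {v : ℕ → Ω → V} (hv : ∀ n, Integrable (v n) μ) {B : ℝ}
    (hB : ∀ n, ∫ x, japaneseBracket (v n x) ∂μ ≤ B)
    (hD : ∀ n, ∫ x, bracketDefect (v n x) (v (n + 1) x) ∂μ ≤ (1 / 16) ^ n) :
    ∀ᵐ x ∂μ, ∃ l, Tendsto (fun n => v n x) atTop (𝓝 l) := by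
  set s : ℕ → Ω → ℝ := fun n x => japaneseBracket (v n x) + japaneseBracket (v (n + 1) x)
  set g : ℕ → Ω → ℝ := fun n x =>
    bracketDefect (v n x) (v (n + 1) x) / ((1 / 2) ^ n) ^ 3 + (1 / 2) ^ n * s n x
  have hs (n : ℕ) : Integrable (s n) μ :=
    (integrable_japaneseBracket (hv n)).add (integrable_japaneseBracket (hv (n + 1)))
  have hDint (n : ℕ) := integrable_bracketDefect (hv n) (hv (n + 1))
  have hgint (n : ℕ) : Integrable (g n) μ :=
    ((hDint n).div_const _).add ((hs n).const_mul _)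
  have hg0 (n : ℕ) (x : Ω) : 0 ≤ g n x := by
    have := bracketDefect_nonneg (v n x) (v (n + 1) x)
    have := add_pos (japaneseBracket_pos (v n x)) (japaneseBracket_pos (v (n + 1) x))
    positivity
  have hgle (n : ℕ) : ∫ x, g n x ∂μ ≤ (1 + 2 * B) * (1 / 2) ^ n := by
    have hsle : ∫ x, s n x ∂μ ≤ 2 * B := by
      rw [integral_add (integrable_japaneseBracket (hv n))
        (integrable_japaneseBracket (hv (n + 1)))]
      linarith [hB n, hB (n + 1)]
    calc ∫ x, g n x ∂μ = (∫ x, bracketDefect (v n x) (v (n + 1) x) ∂μ) / ((1 / 2) ^ n) ^ 3 +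
          (1 / 2) ^ n * ∫ x, s n x ∂μ := by
          rw [integral_add ((hDint n).div_const _) ((hs n).const_mul _), integral_div,
            integral_const_mul]
      _ ≤ (1 / 16) ^ n / ((1 / 2) ^ n) ^ 3 + (1 / 2) ^ n * (2 * B) := by
          gcongr
          exact hD n
      _ = (1 + 2 * B) * (1 / 2) ^ n := by
          rw [← pow_mul, mul_comm n 3, pow_mul, ← div_pow]
          norm_num
          ring
  filter_upwards [ae_summable_of_summable_integral hgint hg0
    (summable_geometric_two.mul_left (1 + 2 * B)) hgle] with x hx
  exact exists_tendsto_of_summable_bracketDefect_add (fun n => by positivity) hx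

theorem integral_bracketDefect [IsFiniteMeasure μ] {p : ℝ≥0∞} [Fact (1 ≤ p)] (v w : Lp V p μ) :
    ∫ x, bracketDefect (v x) (w x) ∂μ = ∫ x, japaneseBracket (v x) ∂μ +
      ∫ x, japaneseBracket (w x) ∂μ - 2 * ∫ x, japaneseBracket (midpoint ℝ v w x) ∂μ := by
  have hint (v : Lp V p μ) : Integrable (fun x => japaneseBracket (v x)) μ :=
    integrable_japaneseBracket ((Lp.memLp v).integrable Fact.out)
  have hmid : (fun x => bracketDefect (v x) (w x)) =ᵐ[μ] fun x =>
      japaneseBracket (v x) + japaneseBracket (w x) - 2 * japaneseBracket (midpoint ℝ v w x) := by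
    filter_upwards [coeFn_midpoint v w] with x hx
    rw [hx, bracketDefect]
  have hadd : Integrable (fun x => japaneseBracket (v x) + japaneseBracket (w x)) μ :=
    (hint v).add (hint w)
  rw [integral_congr_ae hmid, integral_sub hadd ((hint _).const_mul 2),
    integral_add (hint v) (hint w), integral_const_mul]

theorem exists_mem_convexHull_tendsto_ae [IsFiniteMeasure μ] [CompleteSpace V] {p : ℝ≥0∞}
    [Fact (1 ≤ p)] {u : ℕ → Lp V p μ} {R : ℝ} (hR : ∀ n, ‖u n‖ ≤ R) :
    ∃ (v : ℕ → Lp V p μ) (w : Ω → V), (∀ n, v n ∈ convexHull ℝ (u '' Ici n)) ∧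
      ∀ᵐ x ∂μ, Tendsto (fun n => v n x) atTop (𝓝 (w x)) := by
  set A : ℕ → Set (Lp V p μ) := fun n => convexHull ℝ (u '' Ici n)
  set B := μ.real univ + μ.real univ ^ (1 - 1 / p.toReal) * R
  have hint (v : Lp V p μ) : Integrable v μ := (Lp.memLp v).integrable Fact.out
  have hB {v : Lp V p μ} (hv : ‖v‖ ≤ R) : ∫ x, japaneseBracket (v x) ∂μ ≤ B := by
    refine (integral_japaneseBracket_le (hint v)).trans (add_le_add_right ?_ _)
    rw [← setIntegral_univ]
    exact (setIntegral_norm_le_measureReal_rpow_mul_norm v (measure_ne_top μ _)).trans (by gcongr)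
  have hAR (n : ℕ) : ∀ v ∈ A n, ‖v‖ ≤ R := by
    simp only [← mem_closedBall_zero_iff]
    refine convexHull_min ?_ (convex_closedBall 0 R)
    exact image_subset_iff.2 fun m _ => mem_closedBall_zero_iff.2 (hR m)
  obtain ⟨v, hvA, hv⟩ := exists_seq_mem_add_sub_two_mul_midpoint_le (A := A)
    (Ψ := fun v => ∫ x, japaneseBracket (v x) ∂μ)
    (fun i j hij => convexHull_mono (image_mono (Ici_subset_Ici.2 hij)))
    (fun n => convex_convexHull ℝ _) (fun n => (nonempty_Ici.image u).convexHull)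
    (fun v _ => integral_nonneg fun x => (japaneseBracket_pos _).le)
    (fun v hv => hB (hAR 0 v hv)) (ε := fun n => (1 / 16) ^ n) (fun n => by positivity)
    (pow_right_anti₀ (by norm_num) (by norm_num))
  have hdefect (n : ℕ) : ∫ x, bracketDefect (v n x) (v (n + 1) x) ∂μ ≤ (1 / 16) ^ n :=
    (integral_bracketDefect (v n) (v (n + 1))).trans_le (hv n)
  have hlim := ae_exists_tendsto_of_integral_bracketDefect_le (fun n => hint (v n))
    (fun n => hB (hAR n _ (hvA n))) hdefect
  choose! w hw using fun x (hx : ∃ l, Tendsto (fun n => v n x) atTop (𝓝 l)) => hx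
  exact ⟨v, w, hvA, hlim.mono hw⟩

end Komlos

section IntegralFunctional

open Filter Topology

variable {Ω V : Type*} [MeasurableSpace Ω] {μ : Measure Ω}

theorem aemeasurable_superposition [TopologicalSpace V] {g : Ω → V → ℝ}
    (hg : ∀ v, AEMeasurable (fun t => g t v) μ) (hcont : ∀ᵐ t ∂μ, Continuous (g t)) {u : Ω → V}
    (hu : AEStronglyMeasurable u μ) : AEMeasurable (fun t => g t (u t)) μ := by
  classical
  have hsimple (s : SimpleFunc Ω V) : AEMeasurable (fun t => g t (s t)) μ := by
    have hsum : (fun t => g t (s t)) =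
        fun t => ∑ v ∈ s.range, (s ⁻¹' {v}).indicator (fun t => g t v) t := by
      funext t
      rw [Finset.sum_eq_single_of_mem (s t) (s.mem_range_self t)]
      · exact (indicator_of_mem (mem_preimage.2 rfl) fun t => g t (s t)).symm
      · exact fun v _ hv => indicator_of_notMem (fun h => hv h.symm) _
    rw [hsum]
    exact Finset.aemeasurable_fun_sum _ fun v _ => (hg v).indicator (s.measurableSet_fiber v)
  obtain ⟨w, hw, huw⟩ := hu
  have hgw : AEMeasurable (fun t => g t (w t)) μ := by
    refine aemeasurable_of_tendsto_metrizable_ae atTop (fun n => hsimple (hw.approx n)) ?_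
    filter_upwards [hcont] with t ht
    exact (ht.tendsto _).comp (hw.tendsto_approx t)
  refine hgw.congr ?_
  filter_upwards [huw] with t ht
  rw [ht]

variable [NormedAddCommGroup V] [NormedSpace ℝ V]

/-- Convex Carathéodory integrands `g t v`: measurable in `t`, continuous and convex in `v`. -/
structure IsConvexIntegrand (μ : Measure Ω) (g : Ω → V → ℝ) : Prop where
  aemeasurable : ∀ v, AEMeasurable (fun t => g t v) μ
  continuous : ∀ᵐ t ∂μ, Continuous (g t)
  convexOn : ∀ᵐ t ∂μ, ConvexOn ℝ univ (g t)

namespace IsConvexIntegrand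

variable {g : Ω → V → ℝ} {p : ℝ≥0∞}

theorem add_const_fun (hg : IsConvexIntegrand μ g) {c : Ω → ℝ} (hc : AEMeasurable c μ) :
    IsConvexIntegrand μ (fun t v => g t v + c t) where
  aemeasurable v := (hg.aemeasurable v).add hc
  continuous := hg.continuous.mono fun _ ht => ht.add continuous_const
  convexOn := hg.convexOn.mono fun _ ht => ht.add_const _

theorem aemeasurable_comp (hg : IsConvexIntegrand μ g) (u : Lp V p μ) :
    AEMeasurable (fun t => g t (u t)) μ :=
  aemeasurable_superposition hg.aemeasurable hg.continuous (Lp.aestronglyMeasurable u)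

theorem convex_setOf_lintegral_le (hg : IsConvexIntegrand μ g) (γ : ℝ≥0∞) :
    Convex ℝ {u : Lp V p μ | ∫⁻ t, ENNReal.ofReal (g t (u t)) ∂μ ≤ γ} := by
  intro v hv w hw a b ha hb hab
  have hmeas (z : Lp V p μ) : AEMeasurable (fun t => ENNReal.ofReal (g t (z t))) μ :=
    (hg.aemeasurable_comp z).ennreal_ofReal
  calc ∫⁻ t, ENNReal.ofReal (g t ((a • v + b • w : Lp V p μ) t)) ∂μ
      ≤ ∫⁻ t, (ENNReal.ofReal a * ENNReal.ofReal (g t (v t)) +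
          ENNReal.ofReal b * ENNReal.ofReal (g t (w t))) ∂μ := by
        refine lintegral_mono_ae ?_
        filter_upwards [hg.convexOn, Lp.coeFn_add (a • v) (b • w), Lp.coeFn_smul a v,
          Lp.coeFn_smul b w] with t hconv hadd hav hbw
        rw [hadd, Pi.add_apply, hav, hbw, ← ENNReal.ofReal_mul ha, ← ENNReal.ofReal_mul hb]
        exact (ENNReal.ofReal_le_ofReal (hconv.2 (mem_univ _) (mem_univ _) ha hb hab)).trans
          ENNReal.ofReal_add_le
    _ = ENNReal.ofReal a * ∫⁻ t, ENNReal.ofReal (g t (v t)) ∂μ +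
          ENNReal.ofReal b * ∫⁻ t, ENNReal.ofReal (g t (w t)) ∂μ := by
        rw [lintegral_add_left' ((hmeas v).const_mul _), lintegral_const_mul'' _ (hmeas v),
          lintegral_const_mul'' _ (hmeas w)]
    _ ≤ ENNReal.ofReal a * γ + ENNReal.ofReal b * γ := by
        gcongr
        exacts [hv, hw]
    _ = γ := by rw [← add_mul, ← ENNReal.ofReal_add ha hb, hab, ENNReal.ofReal_one, one_mul]

theorem lintegral_le_liminf (hg : IsConvexIntegrand μ g) {v : ℕ → Lp V p μ} {w : Ω → V}
    (hlim : ∀ᵐ t ∂μ, Tendsto (fun n => v n t) atTop (𝓝 (w t))) :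
    ∫⁻ t, ENNReal.ofReal (g t (w t)) ∂μ ≤
      liminf (fun n => ∫⁻ t, ENNReal.ofReal (g t (v n t)) ∂μ) atTop :=
  calc ∫⁻ t, ENNReal.ofReal (g t (w t)) ∂μ
      = ∫⁻ t, liminf (fun n => ENNReal.ofReal (g t (v n t))) atTop ∂μ := by
        refine lintegral_congr_ae ?_
        filter_upwards [hlim, hg.continuous] with t ht hcont
        exact (ENNReal.tendsto_ofReal ((hcont.tendsto _).comp ht)).liminf_eq.symm
    _ ≤ _ := lintegral_liminf_le' fun n => (hg.aemeasurable_comp (v n)).ennreal_ofReal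

theorem lintegral_le_of_mem_convexHull (hg : IsConvexIntegrand μ g) {u v : ℕ → Lp V p μ}
    {w : Ω → V} {γ : ℝ≥0∞}
    (hu : Tendsto (fun n => ∫⁻ t, ENNReal.ofReal (g t (u n t)) ∂μ) atTop (𝓝 γ))
    (hv : ∀ n, v n ∈ convexHull ℝ (u '' Ici n))
    (hlim : ∀ᵐ t ∂μ, Tendsto (fun n => v n t) atTop (𝓝 (w t))) :
    ∫⁻ t, ENNReal.ofReal (g t (w t)) ∂μ ≤ γ := by
  refine le_of_forall_gt_imp_ge_of_dense fun γ' hγ' => (hg.lintegral_le_liminf hlim).trans ?_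
  obtain ⟨N, hN⟩ := eventually_atTop.1 (hu.eventually_le_const hγ')
  refine liminf_le_of_frequently_le' (Eventually.frequently ?_)
  refine eventually_atTop.2 ⟨N, fun n hn => ?_⟩
  refine convexHull_min ?_ (hg.convex_setOf_lintegral_le γ') (hv n)
  exact image_subset_iff.2 fun m hm => hN m (hn.trans hm)

end IsConvexIntegrand

end IntegralFunctional

section WeakCompactness

open Filter Topology

theorem exists_subseq_tendstoUniformlyOn_of_dist_le {X Y : Type*} [PseudoMetricSpace X]
    [MetricSpace Y] {S : Set X} (hS : IsCompact S) {K : Set Y} (hK : IsCompact K)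
    {x : ℕ → X → Y} (hxK : ∀ n, ∀ t ∈ S, x n t ∈ K) {ω : ℝ → ℝ} (hω : Tendsto ω (𝓝 0) (𝓝 0))
    (hx : ∀ n, ∀ s ∈ S, ∀ t ∈ S, dist (x n s) (x n t) ≤ ω (dist s t)) :
    ∃ φ : ℕ → ℕ, StrictMono φ ∧
      ∃ y : X → Y, TendstoUniformlyOn (fun n => x (φ n)) y atTop S := by
  have : CompactSpace S := isCompact_iff_compactSpace.1 hS
  have hequi : UniformEquicontinuous fun (n : ℕ) (t : S) => x n t :=
    Metric.uniformEquicontinuous_of_continuity_modulus ω hω _ fun s t n => hx n s s.2 t t.2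
  let P (n : ℕ) : BoundedContinuousFunction S Y :=
    .mkOfCompact ⟨fun t => x n t, (hequi.uniformContinuous n).continuous⟩
  have hcompact : IsCompact (closure (range P)) := by
    refine BoundedContinuousFunction.arzela_ascoli K hK _ ?_ ?_
    · rintro _ t ⟨n, rfl⟩
      exact hxK n t t.2
    · refine Metric.equicontinuous_of_continuity_modulus ω hω _ ?_
      rintro s t ⟨_, n, rfl⟩
      exact hx n s s.2 t t.2
  obtain ⟨y, -, φ, hφ, hlim⟩ :=
    hcompact.tendsto_subseq fun n => subset_closure (mem_range_self n)
  have hunif : TendstoUniformly (fun n (t : S) => x (φ n) t) y atTop :=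
    BoundedContinuousFunction.tendsto_iff_tendstoUniformly.1 hlim
  refine ⟨φ, hφ, Function.extend (↑) y (x 0), ?_⟩
  rw [tendstoUniformlyOn_iff_tendstoUniformly_comp_coe,
    Function.extend_comp Subtype.val_injective]
  exact hunif

theorem tendsto_of_mem_convexHull_image_Ici {V : Type*} [NormedAddCommGroup V] [NormedSpace ℝ V]
    {x y : ℕ → V} {z : V} (hx : Tendsto x atTop (𝓝 z))
    (hy : ∀ n, y n ∈ convexHull ℝ (x '' Ici n)) : Tendsto y atTop (𝓝 z) := by
  rw [Metric.tendsto_atTop] at hx ⊢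
  intro ε hε
  obtain ⟨N, hN⟩ := hx ε hε
  refine ⟨N, fun n hn => convexHull_min ?_ (convex_ball z ε) (hy n)⟩
  exact image_subset_iff.2 fun m hm => hN m (hn.trans hm)

theorem one_sub_one_div_toReal_pos {p : ℝ≥0∞} (hp : 1 < p) : 0 < 1 - 1 / p.toReal := by
  rcases eq_or_ne p ∞ with rfl | hp'
  · simp
  · have : 1 < p.toReal := by simpa using ENNReal.toReal_strict_mono hp' hp
    exact sub_pos.2 ((div_lt_one (by linarith)).2 this)

theorem tendsto_rpow_mul_nhds_zero {p : ℝ≥0∞} (hp : 1 < p) (R : ℝ) :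
    Tendsto (fun r : ℝ => r ^ (1 - 1 / p.toReal) * R) (𝓝 0) (𝓝 0) := by
  have hexp := one_sub_one_div_toReal_pos hp
  have h := (Real.continuousAt_rpow_const 0 _ (Or.inr hexp.le)).tendsto.mul_const R
  rwa [Real.zero_rpow hexp.ne', zero_mul] at h

section Lp

variable {Ω V : Type*} [MeasurableSpace Ω] {μ : Measure Ω} [NormedAddCommGroup V] {p : ℝ≥0∞}
  [Fact (1 ≤ p)]

theorem memLp_of_tendsto_ae {v : ℕ → Lp V p μ} {w : Ω → V} {R : ℝ} (hv : ∀ n, ‖v n‖ ≤ R)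
    (hlim : ∀ᵐ t ∂μ, Tendsto (fun n => v n t) atTop (𝓝 (w t))) : MemLp w p μ := by
  refine ⟨aestronglyMeasurable_of_tendsto_ae atTop (fun n => Lp.aestronglyMeasurable (v n)) hlim,
    ?_⟩
  have hbound (n : ℕ) : eLpNorm (v n) p μ ≤ ENNReal.ofReal R := by
    rw [← Lp.enorm_def, ← ofReal_norm]
    exact ENNReal.ofReal_le_ofReal (hv n)
  calc eLpNorm w p μ ≤ liminf (fun n => eLpNorm (v n) p μ) atTop :=
        Lp.eLpNorm_lim_le_liminf_eLpNorm (fun n => Lp.aestronglyMeasurable (v n)) w hlim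
    _ ≤ ENNReal.ofReal R := liminf_le_of_frequently_le' (.of_forall hbound)
    _ < ∞ := ENNReal.ofReal_lt_top


theorem unifIntegrable_of_norm_le [IsFiniteMeasure μ] (hp : 1 < p) {ι : Type*} {v : ι → Lp V p μ}
    {R : ℝ} (hv : ∀ i, ‖v i‖ ≤ R) : UnifIntegrable (fun i => v i) 1 μ := by
  intro ε hε
  obtain ⟨δ, hδ, hmod⟩ := Metric.tendsto_nhds_nhds.1 (tendsto_rpow_mul_nhds_zero hp R) ε hε
  refine ⟨δ / 2, by positivity, fun i s hs hμs => ?_⟩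
  have hv1 : Integrable (v i) (μ.restrict s) := ((Lp.memLp (v i)).integrable Fact.out).restrict
  have hμδ : μ.real s ≤ δ / 2 := ENNReal.toReal_le_of_le_ofReal (by positivity) hμs
  rw [eLpNorm_indicator_eq_eLpNorm_restrict hs, eLpNorm_one_eq_lintegral_enorm,
    ← ofReal_integral_norm_eq_lintegral_enorm hv1]
  refine ENNReal.ofReal_le_ofReal ?_
  calc ∫ t in s, ‖v i t‖ ∂μ ≤ μ.real s ^ (1 - 1 / p.toReal) * ‖v i‖ :=
        setIntegral_norm_le_measureReal_rpow_mul_norm (v i) (measure_ne_top μ s)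
    _ ≤ μ.real s ^ (1 - 1 / p.toReal) * R := by gcongr; exact hv i
    _ ≤ dist (μ.real s ^ (1 - 1 / p.toReal) * R) 0 := by
        rw [Real.dist_0_eq_abs]; exact le_abs_self _
    _ ≤ ε := (hmod (by rw [Real.dist_0_eq_abs, abs_of_nonneg measureReal_nonneg]; linarith)).le

variable [NormedSpace ℝ V]

theorem tendsto_setIntegral_of_tendsto_ae [IsFiniteMeasure μ] (hp : 1 < p)
    {v : ℕ → Lp V p μ} {w : Ω → V} {R : ℝ} (hv : ∀ n, ‖v n‖ ≤ R)
    (hlim : ∀ᵐ t ∂μ, Tendsto (fun n => v n t) atTop (𝓝 (w t))) (s : Set Ω) :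
    Tendsto (fun n => ∫ t in s, v n t ∂μ) atTop (𝓝 (∫ t in s, w t ∂μ)) := by
  have hw : Integrable w μ := (memLp_of_tendsto_ae hv hlim).integrable Fact.out
  have hL1 : Tendsto (fun n => eLpNorm (⇑(v n) - w) 1 μ) atTop (𝓝 0) :=
    tendsto_Lp_finite_of_tendsto_ae le_rfl ENNReal.one_ne_top
      (fun n => Lp.aestronglyMeasurable (v n)) (memLp_one_iff_integrable.2 hw)
      (unifIntegrable_of_norm_le hp hv) hlim
  exact tendsto_setIntegral_of_L1' w hw.aestronglyMeasurable
    (.of_forall fun n => (Lp.memLp (v n)).integrable Fact.out) hL1 s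

theorem isLinearMap_setIntegral_coeFn [IsFiniteMeasure μ] (s : Set Ω) :
    IsLinearMap ℝ fun u : Lp V p μ => ∫ t in s, u t ∂μ where
  map_add u v := by
    have hint (w : Lp V p μ) : IntegrableOn w s μ :=
      ((Lp.memLp w).integrable Fact.out).integrableOn
    rw [← integral_add (hint u) (hint v)]
    exact integral_congr_ae (ae_restrict_of_ae (Lp.coeFn_add u v))
  map_smul c u := by
    rw [← integral_smul]
    exact integral_congr_ae (ae_restrict_of_ae (Lp.coeFn_smul c u))

theorem tendsto_setIntegral_of_mem_convexHull [IsFiniteMeasure μ] {u v : ℕ → Lp V p μ} {s : Set Ω}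
    {z : V} (hu : Tendsto (fun n => ∫ t in s, u n t ∂μ) atTop (𝓝 z))
    (hv : ∀ n, v n ∈ convexHull ℝ (u '' Ici n)) :
    Tendsto (fun n => ∫ t in s, v n t ∂μ) atTop (𝓝 z) := by
  refine tendsto_of_mem_convexHull_image_Ici hu fun n => ?_
  have h := mem_image_of_mem (fun u : Lp V p μ => ∫ t in s, u t ∂μ) (hv n)
  rwa [(isLinearMap_setIntegral_coeFn s).image_convexHull, image_image] at h

end Lp

section Primitive

variable {V : Type*} [NormedAddCommGroup V] {p : ℝ≥0∞} [Fact (1 ≤ p)] {a b : ℝ}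

theorem intervalIntegrable_coeFn (u : Lp V p (volume.restrict (Icc a b))) (hab : a ≤ b) :
    IntervalIntegrable u volume a b :=
  (intervalIntegrable_iff_integrableOn_Icc_of_le hab).2 ((Lp.memLp u).integrable Fact.out)

theorem intervalIntegral_eq_setIntegral_restrict_Icc [NormedSpace ℝ V] (f : ℝ → V) {s t : ℝ}
    (hs : a ≤ s) (hst : s ≤ t) (ht : t ≤ b) :
    ∫ r in s..t, f r = ∫ r in Ioc s t, f r ∂(volume.restrict (Icc a b)) := by
  rw [intervalIntegral.integral_of_le hst, Measure.restrict_restrict measurableSet_Ioc,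
    inter_eq_left.2 (Ioc_subset_Icc_self.trans (Icc_subset_Icc hs ht))]

theorem intervalIntegral_norm_le_mul_norm (u : Lp V p (volume.restrict (Icc a b))) {s t : ℝ}
    (hs : a ≤ s) (hst : s ≤ t) (ht : t ≤ b) :
    ∫ r in s..t, ‖u r‖ ≤ (t - s) ^ (1 - 1 / p.toReal) * ‖u‖ := by
  have hvol : (volume.restrict (Icc a b)).real (Ioc s t) = t - s := by
    rw [measureReal_restrict_apply measurableSet_Ioc,
      inter_eq_left.2 (Ioc_subset_Icc_self.trans (Icc_subset_Icc hs ht)),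
      Real.volume_real_Ioc_of_le hst]
  rw [intervalIntegral_eq_setIntegral_restrict_Icc _ hs hst ht, ← hvol]
  exact setIntegral_norm_le_measureReal_rpow_mul_norm u (measure_ne_top _ _)

variable [NormedSpace ℝ V]

theorem dist_primitive_le (u : Lp V p (volume.restrict (Icc a b))) {s t : ℝ} (hs : s ∈ Icc a b)
    (ht : t ∈ Icc a b) :
    dist (∫ r in a..s, u r) (∫ r in a..t, u r) ≤ dist s t ^ (1 - 1 / p.toReal) * ‖u‖ := by
  wlog hst : s ≤ t generalizing s t
  · rw [dist_comm, dist_comm s]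
    exact this ht hs (le_of_not_ge hst)
  have hint := intervalIntegrable_coeFn u (hs.1.trans hs.2)
  rw [dist_comm, dist_eq_norm, intervalIntegral.integral_interval_sub_left
    (intervalIntegrable_of_mem_Icc hint ht) (intervalIntegrable_of_mem_Icc hint hs),
    dist_comm, Real.dist_eq, abs_of_nonneg (sub_nonneg.2 hst)]
  exact (intervalIntegral.norm_integral_le_integral_norm hst).trans
    (intervalIntegral_norm_le_mul_norm u hs.1 hst ht.2)

theorem exists_subseq_tendstoUniformlyOn_primitive [ProperSpace V] (hp : 1 < p)
    {u : ℕ → Lp V p (volume.restrict (Icc a b))} {R : ℝ} (hu : ∀ n, ‖u n‖ ≤ R) :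
    ∃ φ : ℕ → ℕ, StrictMono φ ∧ ∃ U : ℝ → V,
      TendstoUniformlyOn (fun n t => ∫ s in a..t, u (φ n) s) U atTop (Icc a b) := by
  have hmod (n : ℕ) {s t : ℝ} (hs : s ∈ Icc a b) (ht : t ∈ Icc a b) :
      dist (∫ r in a..s, u n r) (∫ r in a..t, u n r) ≤ dist s t ^ (1 - 1 / p.toReal) * R :=
    (dist_primitive_le (u n) hs ht).trans (by gcongr; exact hu n)
  refine exists_subseq_tendstoUniformlyOn_of_dist_le isCompact_Icc
    (isCompact_closedBall (0 : V) ((b - a) ^ (1 - 1 / p.toReal) * R)) (fun n t ht => ?_)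
    (tendsto_rpow_mul_nhds_zero hp R) fun n s hs t ht => hmod n hs ht
  have h := hmod n (left_mem_Icc.2 (ht.1.trans ht.2)) ht
  rw [intervalIntegral.integral_same, dist_comm, dist_comm a, Real.dist_eq,
    abs_of_nonneg (sub_nonneg.2 ht.1)] at h
  refine mem_closedBall_zero_iff.2 ((dist_zero_right (∫ s in a..t, u n s) ▸ h).trans ?_)
  have hR : 0 ≤ R := (norm_nonneg _).trans (hu n)
  have hexp := one_sub_one_div_toReal_pos hp
  have hat := sub_nonneg.2 ht.1
  have htb := ht.2
  gcongr

/-- Sequential weak compactness of bounded subsets of `L^p`, in terms of primitives and of forward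
convex combinations. -/
theorem exists_subseq_tendstoUniformlyOn_primitive_mem_convexHull {V : Type*}
    [NormedAddCommGroup V] [InnerProductSpace ℝ V] [ProperSpace V] (hp : 1 < p)
    {u : ℕ → Lp V p (volume.restrict (Icc a b))} {R : ℝ} (hu : ∀ n, ‖u n‖ ≤ R) :
    ∃ φ : ℕ → ℕ, StrictMono φ ∧ ∃ (v : ℕ → Lp V p (volume.restrict (Icc a b)))
      (w : Lp V p (volume.restrict (Icc a b))),
      TendstoUniformlyOn (fun n t => ∫ s in a..t, u (φ n) s) (fun t => ∫ s in a..t, w s) atTop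
        (Icc a b) ∧
      (∀ n, v n ∈ convexHull ℝ ((fun j => u (φ j)) '' Ici n)) ∧
      ∀ᵐ t ∂(volume.restrict (Icc a b)), Tendsto (fun n => v n t) atTop (𝓝 (w t)) := by
  obtain ⟨φ, hφ, U, hU⟩ := exists_subseq_tendstoUniformlyOn_primitive hp hu
  obtain ⟨v, w, hv, hvw⟩ := exists_mem_convexHull_tendsto_ae fun n => hu (φ n)
  have hvR (n : ℕ) : ‖v n‖ ≤ R := by
    simp only [← mem_closedBall_zero_iff] at hu ⊢
    refine convexHull_min ?_ (convex_closedBall 0 R) (hv n)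
    rintro _ ⟨m, -, rfl⟩
    exact hu (φ m)
  have hmem := memLp_of_tendsto_ae hvR hvw
  have hw := hmem.coeFn_toLp
  refine ⟨φ, hφ, v, hmem.toLp w, hU.congr_right fun t ht => ?_, hv, ?_⟩
  rotate_left
  · filter_upwards [hvw, hw] with t ht hwt
    rwa [hwt]
  have hset (f : ℝ → V) := intervalIntegral_eq_setIntegral_restrict_Icc f le_rfl ht.1 ht.2
  have hlim := hU.tendsto_at ht
  simp only [hset] at hlim ⊢
  rw [integral_congr_ae (ae_restrict_of_ae hw)]
  exact tendsto_nhds_unique (tendsto_setIntegral_of_mem_convexHull hlim hv)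
    (tendsto_setIntegral_of_tendsto_ae hp hvR hvw _)

end Primitive

end WeakCompactness

section DirectMethod

open Filter Topology

theorem exists_forall_le_of_tendsto {X α : Type*} [Nonempty X] [CompleteLinearOrder α]
    [TopologicalSpace α] [OrderTopology α] [FirstCountableTopology α] {J : X → α}
    (hJ : ∀ (u : ℕ → X) (M γ : α), M < ⊤ → (∀ n, J (u n) ≤ M) →
      Tendsto (fun n => J (u n)) atTop (𝓝 γ) → ∃ w, J w ≤ γ) :
    ∃ w, ∀ u, J w ≤ J u := by
  obtain ⟨y, hanti, hlim, hy⟩ := exists_seq_tendsto_sInf (range_nonempty J) (OrderBot.bddBelow _)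
  choose u hu using hy
  rcases eq_top_or_lt_top (sInf (range J)) with htop | htop
  · refine ⟨u 0, fun z => ?_⟩
    rw [sInf_eq_top.1 htop _ (mem_range_self z)]
    exact le_top
  · obtain ⟨N, hN⟩ := (hlim.eventually (gt_mem_nhds htop)).exists
    obtain ⟨w, hw⟩ := hJ (fun n => u (n + N)) (y N) (sInf (range J)) hN
      (fun n => (hu _).trans_le (hanti (Nat.le_add_left N n)))
      (by simpa only [hu] using (tendsto_add_atTop_iff_nat N).2 hlim)
    exact ⟨w, fun z => hw.trans (sInf_le (mem_range_self z))⟩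

theorem norm_le_of_lintegral_le_of_coercive {Ω V : Type*} [MeasurableSpace Ω] {μ : Measure Ω}
    [NormedAddCommGroup V] {p : ℝ≥0∞} (hp₀ : p ≠ 0) (hp : p ≠ ∞) {g : Ω → V → ℝ} {C : ℝ}
    (hC : 0 < C) (hg : ∀ᵐ t ∂μ, ∀ v, C * ‖v‖ ^ p.toReal ≤ g t v) {u : Lp V p μ} {M : ℝ≥0∞}
    (hM : M ≠ ∞) (hu : ∫⁻ t, ENNReal.ofReal (g t (u t)) ∂μ ≤ M) :
    ‖u‖ ≤ ((M / ENNReal.ofReal C) ^ (1 / p.toReal)).toReal := by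
  have hC' : ENNReal.ofReal C ≠ 0 := by simpa using hC
  have hbound : ENNReal.ofReal C * ∫⁻ t, ‖u t‖ₑ ^ p.toReal ∂μ ≤ M := by
    rw [← lintegral_const_mul' _ _ ENNReal.ofReal_ne_top]
    refine (lintegral_mono_ae ?_).trans hu
    filter_upwards [hg] with t ht
    rw [← ofReal_norm, ENNReal.ofReal_rpow_of_nonneg (norm_nonneg _) ENNReal.toReal_nonneg,
      ← ENNReal.ofReal_mul hC.le]
    exact ENNReal.ofReal_le_ofReal (ht _)
  rw [Lp.norm_def, eLpNorm_eq_lintegral_rpow_enorm_toReal hp₀ hp]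
  refine ENNReal.toReal_mono
    (ENNReal.rpow_ne_top_of_nonneg (by positivity) (ENNReal.div_ne_top hM hC')) ?_
  gcongr
  rwa [ENNReal.le_div_iff_mul_le (.inl hC') (.inl ENNReal.ofReal_ne_top), mul_comm]

theorem IsConvexIntegrand.exists_subseq_tendstoUniformlyOn_primitive {V : Type*}
    [NormedAddCommGroup V] [InnerProductSpace ℝ V] [ProperSpace V] {p : ℝ≥0∞} [Fact (1 ≤ p)]
    (hp : 1 < p) {a b : ℝ} {g : ℝ → V → ℝ}
    (hg : IsConvexIntegrand (volume.restrict (Icc a b)) g)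
    {u : ℕ → Lp V p (volume.restrict (Icc a b))} {R : ℝ} (hu : ∀ n, ‖u n‖ ≤ R) :
    ∃ φ : ℕ → ℕ, StrictMono φ ∧ ∃ (w : Lp V p (volume.restrict (Icc a b))) (γ : ℝ≥0∞),
      TendstoUniformlyOn (fun n t => ∫ s in a..t, u (φ n) s) (fun t => ∫ s in a..t, w s) atTop
        (Icc a b) ∧
      Tendsto (fun n => ∫⁻ t in Icc a b, ENNReal.ofReal (g t (u (φ n) t))) atTop (𝓝 γ) ∧
      ∫⁻ t in Icc a b, ENNReal.ofReal (g t (w t)) ≤ γ := by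
  obtain ⟨γ, -, φ, hφ, hγ⟩ := isCompact_univ.tendsto_subseq
    fun n => mem_univ (∫⁻ t in Icc a b, ENNReal.ofReal (g t (u n t)))
  obtain ⟨ψ, hψ, v, w, hprim, hv, hvw⟩ :=
    exists_subseq_tendstoUniformlyOn_primitive_mem_convexHull hp fun n => hu (φ n)
  have hγ' := hγ.comp hψ.tendsto_atTop
  exact ⟨φ ∘ ψ, hφ.comp hψ, w, γ, hprim, hγ', hg.lintegral_le_of_mem_convexHull hγ' hv hvw⟩

end DirectMethod

section MinimaxCost

open Filter Topology

variable {d k l : ℕ} {Θ : Set (E l)} {T L : ℝ} {F₀ : E d → Θ → E d} {F : Fin k → E d → Θ → E d}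
  {x₀ : Θ → E d} {a : E d → Θ → ℝ}

theorem IsEnsembleLipschitz.exists_forall_terminalCost_le [CompactSpace Θ] [Nonempty Θ]
    (hF : IsEnsembleLipschitz L F₀ F) (hT : 0 ≤ T) (hx₀ : Continuous x₀)
    (ha : Continuous fun q : E d × Θ => a q.1 q.2) {u : ℝ → E k}
    (hu : IntervalIntegrable u volume 0 T) :
    ∃ θ' : Θ, ∀ θ : Θ,
      a (evolution T F₀ F x₀ u T θ) θ ≤ a (evolution T F₀ F x₀ u T θ') θ' := by
  have hcont : Continuous fun θ => a (evolution T F₀ F x₀ u T θ) θ :=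
    ha.comp ((hF.continuous_evolution hT hu hx₀ (right_mem_Icc.2 hT)).prodMk continuous_id)
  obtain ⟨θ', -, hmax⟩ := isCompact_univ.exists_isMaxOn univ_nonempty hcont.continuousOn
  exact ⟨θ', fun θ => hmax (mem_univ θ)⟩

/-- The minimax functional for nonnegative costs, with values in `[0, ∞]`. It is used for the
running cost shifted by its integrable lower bound, which avoids subtraction in `EReal`. -/
noncomputable def minimaxENNRealCost (T : ℝ) (F₀ : E d → Θ → E d) (F : Fin k → E d → Θ → E d)
    (x₀ : Θ → E d) (a : E d → Θ → ℝ) (g : ℝ → E k → ℝ) (u : ℝ → E k) : ℝ≥0∞ :=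
  (⨆ θ : Θ, ENNReal.ofReal (a (evolution T F₀ F x₀ u T θ) θ)) +
    ∫⁻ t in Icc (0 : ℝ) T, ENNReal.ofReal (g t (u t))

theorem IsEnsembleLipschitz.minimaxENNRealCost_le_of_tendsto [Nonempty Θ] {p : ℝ≥0∞}
    [Fact (1 ≤ p)]
    (hF : IsEnsembleLipschitz L F₀ F) (hT : 0 ≤ T) (ha : ∀ θ, Continuous fun x => a x θ)
    {g : ℝ → E k → ℝ} {u : ℕ → Lp (E k) p (volume.restrict (Icc 0 T))}
    {w : Lp (E k) p (volume.restrict (Icc 0 T))} {R : ℝ} {γ η : ℝ≥0∞} (hu : ∀ n, ‖u n‖ ≤ R)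
    (hprim : TendstoUniformlyOn (fun n t => ∫ s in 0..t, u n s) (fun t => ∫ s in 0..t, w s) atTop
      (Icc 0 T))
    (hη : Tendsto (fun n => ∫⁻ t in Icc 0 T, ENNReal.ofReal (g t (u n t))) atTop (𝓝 η))
    (hw : ∫⁻ t in Icc 0 T, ENNReal.ofReal (g t (w t)) ≤ η)
    (hγ : Tendsto (fun n => minimaxENNRealCost T F₀ F x₀ a g (u n)) atTop (𝓝 γ)) :
    minimaxENNRealCost T F₀ F x₀ a g w ≤ γ := by
  have hint (v : Lp (E k) p (volume.restrict (Icc 0 T))) := intervalIntegrable_coeFn v hT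
  have hL1 (n : ℕ) : ∫ s in 0..T, ‖u n s‖ ≤ (T - 0) ^ (1 - 1 / p.toReal) * R :=
    (intervalIntegral_norm_le_mul_norm (u n) le_rfl hT le_rfl).trans (by gcongr; exact hu n)
  rw [minimaxENNRealCost, ENNReal.iSup_add]
  refine iSup_le fun θ => ?_
  have hlim : Tendsto (fun n => evolution T F₀ F x₀ (u n) T θ) atTop
      (𝓝 (evolution T F₀ F x₀ w T θ)) :=
    (hF.tendstoUniformlyOn_evolution hT (fun n => hint (u n)) (hint w) hL1 hprim θ).tendsto_at
      (right_mem_Icc.2 hT)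
  have hterm := ENNReal.tendsto_ofReal (((ha θ).tendsto _).comp hlim)
  refine (add_le_add_right hw _).trans (le_of_tendsto_of_tendsto' (hterm.add hη) hγ fun n => ?_)
  exact add_le_add_left
    (le_iSup (fun θ : Θ => ENNReal.ofReal (a (evolution T F₀ F x₀ (u n) T θ) θ)) θ) _

theorem IsEnsembleLipschitz.exists_forall_minimaxENNRealCost_le [Nonempty Θ] {p : ℝ≥0∞}
    [Fact (1 ≤ p)] (hF : IsEnsembleLipschitz L F₀ F) (hT : 0 ≤ T) (hp : 1 < p) (hp' : p ≠ ∞)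
    (ha : ∀ θ, Continuous fun x => a x θ) {g : ℝ → E k → ℝ}
    (hg : IsConvexIntegrand (volume.restrict (Icc 0 T)) g) {C : ℝ} (hC : 0 < C)
    (hgC : ∀ᵐ t ∂(volume.restrict (Icc 0 T)), ∀ v, C * ‖v‖ ^ p.toReal ≤ g t v) :
    ∃ w : Lp (E k) p (volume.restrict (Icc 0 T)),
      ∀ u : Lp (E k) p (volume.restrict (Icc 0 T)),
        minimaxENNRealCost T F₀ F x₀ a g w ≤ minimaxENNRealCost T F₀ F x₀ a g u := by
  refine exists_forall_le_of_tendsto fun u M γ hM hu hγ => ?_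
  have hnorm (n : ℕ) := norm_le_of_lintegral_le_of_coercive (zero_lt_one.trans hp).ne' hp' hC hgC
    hM.ne (le_add_self.trans (hu n))
  obtain ⟨φ, hφ, w, η, hprim, hη, hw⟩ := hg.exists_subseq_tendstoUniformlyOn_primitive hp hnorm
  exact ⟨w, hF.minimaxENNRealCost_le_of_tendsto hT ha (fun n => hnorm (φ n)) hprim hη hw
    (hγ.comp hφ.tendsto_atTop)⟩

theorem coe_ennreal_iSup {ι : Type*} [Nonempty ι] (x : ι → ℝ≥0∞) :
    ((⨆ i, x i : ℝ≥0∞) : EReal) = ⨆ i, (x i : EReal) :=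
  EReal.coe_ennreal_strictMono.monotone.map_ciSup_of_continuousAt
    continuous_coe_ennreal_ereal.continuousAt (OrderTop.bddAbove _)

theorem coe_ennreal_sub_eq_of_add_eq_add {x y z w : ℝ≥0∞} (h : x + w = z + y) (hy : y ≠ ∞)
    (hw : w ≠ ∞) : (x : EReal) - y = z - w := by
  lift y to NNReal using hy
  lift w to NNReal using hw
  induction x with
  | top =>
    obtain rfl : z = ∞ := by simpa using h.symm
    simp
  | coe x =>
    lift z to NNReal using fun hz => by simp [hz] at h
    have h' : (x : ℝ) + w = z + y := mod_cast h
    simp only [EReal.coe_nnreal_eq_coe_real, ← EReal.coe_sub, EReal.coe_eq_coe_iff]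
    linarith

/-- The coercivity condition `C ‖v‖ ^ p - c t ≤ g t v` with a nonnegative integrable defect `c`. -/
structure IsCoerciveIntegrand {Ω V : Type*} [MeasurableSpace Ω] [Norm V] (μ : Measure Ω) (p : ℝ)
    (c : Ω → ℝ) (g : Ω → V → ℝ) : Prop where
  integrable : Integrable c μ
  nonneg : ∀ᵐ t ∂μ, 0 ≤ c t
  exists_le : ∃ C > 0, ∀ᵐ t ∂μ, ∀ v, C * ‖v‖ ^ p - c t ≤ g t v

namespace IsCoerciveIntegrand

variable {Ω V : Type*} [MeasurableSpace Ω] [NormedAddCommGroup V] {μ : Measure Ω} {p : ℝ}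
  {c : Ω → ℝ} {g : Ω → V → ℝ}

theorem nonneg_add (hg : IsCoerciveIntegrand μ p c g) (u : Ω → V) :
    ∀ᵐ t ∂μ, 0 ≤ g t (u t) + c t := by
  obtain ⟨C, hC, hle⟩ := hg.exists_le
  filter_upwards [hle] with t ht
  exact (by positivity : 0 ≤ C * ‖u t‖ ^ p).trans (sub_le_iff_le_add.1 (ht (u t)))

theorem lintegral_ofReal_neg_ne_top (hg : IsCoerciveIntegrand μ p c g) (u : Ω → V) :
    ∫⁻ t, ENNReal.ofReal (-g t (u t)) ∂μ ≠ ∞ := by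
  refine ne_top_of_le_ne_top hg.integrable.lintegral_lt_top.ne (lintegral_mono_ae ?_)
  filter_upwards [hg.nonneg_add u] with t ht
  exact ENNReal.ofReal_le_ofReal (neg_le_iff_add_nonneg'.2 ht)

theorem lintegral_ofReal_add (hg : IsCoerciveIntegrand μ p c g) {u : Ω → V}
    (hu : AEMeasurable (fun t => g t (u t)) μ) :
    ∫⁻ t, ENNReal.ofReal (g t (u t)) ∂μ + ∫⁻ t, ENNReal.ofReal (c t) ∂μ =
      ∫⁻ t, ENNReal.ofReal (g t (u t) + c t) ∂μ + ∫⁻ t, ENNReal.ofReal (-g t (u t)) ∂μ := by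
  have hadd : AEMeasurable (fun t => g t (u t) + c t) μ := hu.add hg.integrable.aemeasurable
  rw [← lintegral_add_left' hu.ennreal_ofReal, ← lintegral_add_left' hadd.ennreal_ofReal]
  refine lintegral_congr_ae ?_
  filter_upwards [hg.nonneg, hg.nonneg_add u] with t htc htgc
  rcases le_total 0 (g t (u t)) with h | h
  · rw [ENNReal.ofReal_of_nonpos (neg_nonpos.2 h), add_zero, ENNReal.ofReal_add h htc]
  · rw [ENNReal.ofReal_of_nonpos h, zero_add, ← ENNReal.ofReal_add htgc (neg_nonneg.2 h),
      add_neg_cancel_comm]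

end IsCoerciveIntegrand

section ExtendedRealCost

variable {p : ℝ} {f : ℝ → E k → ℝ} {c : ℝ → ℝ}

theorem minimaxCost_eq_sub [Nonempty Θ] (ha : ∀ x θ, 0 ≤ a x θ)
    (hf : IsConvexIntegrand (volume.restrict (Icc 0 T)) f)
    (hfc : IsCoerciveIntegrand (volume.restrict (Icc 0 T)) p c f) (u : ControlSpace T p k) :
    minimaxCost T F₀ F x₀ a f u =
      (minimaxENNRealCost T F₀ F x₀ a (fun t v => f t v + c t) u : EReal) -
        ((∫⁻ t in Icc 0 T, ENNReal.ofReal (c t) : ℝ≥0∞) : EReal) := by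
  have hext := coe_ennreal_sub_eq_of_add_eq_add (hfc.lintegral_ofReal_add (hf.aemeasurable_comp u))
    (hfc.lintegral_ofReal_neg_ne_top u) hfc.integrable.lintegral_lt_top.ne
  simp only [minimaxCost, minimaxENNRealCost, extIntegral, hext,
    EReal.coe_ennreal_add, coe_ennreal_iSup, EReal.coe_ennreal_ofReal, max_eq_left (ha _ _),
    sub_eq_add_neg, add_assoc]

theorem minimaxCost_ne_bot [Nonempty Θ] (ha : ∀ x θ, 0 ≤ a x θ)
    (hf : IsConvexIntegrand (volume.restrict (Icc 0 T)) f)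
    (hfc : IsCoerciveIntegrand (volume.restrict (Icc 0 T)) p c f) (u : ControlSpace T p k) :
    minimaxCost T F₀ F x₀ a f u ≠ ⊥ := by
  rw [minimaxCost_eq_sub ha hf hfc, sub_eq_add_neg]
  refine EReal.add_ne_bot_iff.2 ⟨EReal.coe_ennreal_ne_bot _, ?_⟩
  simpa using hfc.integrable.lintegral_lt_top.ne

theorem minimaxCost_ne_top {u : ControlSpace T p k} {θ' : Θ}
    (hmax : ∀ θ, a (evolution T F₀ F x₀ u T θ) θ ≤ a (evolution T F₀ F x₀ u T θ') θ')
    (hc : IntegrableOn c (Icc 0 T))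
    (hfc : ∀ᵐ t ∂(volume.restrict (Icc 0 T)), f t (u t) ≤ c t) :
    minimaxCost T F₀ F x₀ a f u ≠ ⊤ := by
  have hpos : ∫⁻ t in Icc 0 T, ENNReal.ofReal (f t (u t)) ≠ ∞ :=
    ne_top_of_le_ne_top hc.lintegral_lt_top.ne
      (lintegral_mono_ae (hfc.mono fun _ ht => ENNReal.ofReal_le_ofReal ht))
  have hext : extIntegral T (fun t => f t (u t)) ≠ ⊤ := by
    rw [extIntegral, sub_eq_add_neg]
    exact EReal.add_ne_top (by simpa using hpos) (by simp)
  exact EReal.add_ne_top (ne_top_of_le_ne_top (EReal.coe_ne_top _)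
    (iSup_le fun θ => EReal.coe_le_coe_iff.2 (hmax θ))) hext

theorem IsEnsembleLipschitz.exists_minimaxCost_ne_top [CompactSpace Θ] [Nonempty Θ]
    [Fact (1 ≤ ENNReal.ofReal p)] (hF : IsEnsembleLipschitz L F₀ F) (hT : 0 ≤ T)
    (hx₀ : Continuous x₀) (ha : Continuous fun q : E d × Θ => a q.1 q.2) {v : E k}
    (hc : IntegrableOn c (Icc 0 T)) (hfc : ∀ᵐ t ∂(volume.restrict (Icc 0 T)), f t v ≤ c t) :
    ∃ u : ControlSpace T p k, minimaxCost T F₀ F x₀ a f u ≠ ⊤ := by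
  have hv : MemLp (fun _ => v) (ENNReal.ofReal p) (volume.restrict (Icc 0 T)) := memLp_const v
  obtain ⟨θ', hmax⟩ := hF.exists_forall_terminalCost_le hT hx₀ ha
    (intervalIntegrable_coeFn (hv.toLp _) hT)
  refine ⟨hv.toLp _, minimaxCost_ne_top hmax hc ?_⟩
  filter_upwards [hv.coeFn_toLp, hfc] with t htv htc
  rwa [htv]

theorem IsEnsembleLipschitz.exists_forall_minimaxCost_le [Nonempty Θ]
    (hF : IsEnsembleLipschitz L F₀ F) (hT : 0 ≤ T) (hp : 1 < p)
    (ha : ∀ θ, Continuous fun x => a x θ) (ha_nonneg : ∀ x θ, 0 ≤ a x θ)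
    (hf : IsConvexIntegrand (volume.restrict (Icc 0 T)) f)
    (hfc : IsCoerciveIntegrand (volume.restrict (Icc 0 T)) p c f) :
    ∃ w : ControlSpace T p k, ∀ u : ControlSpace T p k,
      minimaxCost T F₀ F x₀ a f w ≤ minimaxCost T F₀ F x₀ a f u := by
  have hp' : 1 < ENNReal.ofReal p := ENNReal.one_lt_ofReal.2 hp
  have : Fact (1 ≤ ENNReal.ofReal p) := ⟨hp'.le⟩
  obtain ⟨C, hC, hle⟩ := hfc.exists_le
  have hcoercive : ∀ᵐ t ∂(volume.restrict (Icc 0 T)),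
      ∀ v, C * ‖v‖ ^ (ENNReal.ofReal p).toReal ≤ f t v + c t := by
    rw [ENNReal.toReal_ofReal (zero_lt_one.trans hp).le]
    exact hle.mono fun t ht v => sub_le_iff_le_add.1 (ht v)
  obtain ⟨w, hw⟩ := hF.exists_forall_minimaxENNRealCost_le hT hp' ENNReal.ofReal_ne_top ha
    (hf.add_const_fun hfc.integrable.aemeasurable) hC hcoercive
  refine ⟨w, fun u => ?_⟩
  simp only [minimaxCost_eq_sub ha_nonneg hf hfc]
  exact EReal.sub_le_sub (EReal.coe_ennreal_le_coe_ennreal_iff.2 (hw u)) le_rfl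

end ExtendedRealCost

end MinimaxCost

theorem mainTheorem1 {d k l : ℕ} (Θ : Set (E l)) (hΘ : IsCompact Θ) (hΘne : Θ.Nonempty)
    (T p : ℝ) (hT : 0 < T) (hp : 1 < p)
    (F₀ : E d → Θ → E d) (F : Fin k → E d → Θ → E d) (x₀ : Θ → E d)
    (a : E d → Θ → ℝ) (f : ℝ → E k → ℝ)
    -- Lipschitz dynamics
    (hF : ∃ L : ℝ, 0 < L ∧ ∀ (x₁ x₂ : E d) (θ₁ θ₂ : Θ),
      ‖F₀ x₁ θ₁ - F₀ x₂ θ₂‖ ≤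
        L * (‖x₁ - x₂‖ + ‖x₁ + x₂‖ * ‖(θ₁ : E l) - (θ₂ : E l)‖) ∧
      ∀ i : Fin k, ‖F i x₁ θ₁ - F i x₂ θ₂‖ ≤
        L * (‖x₁ - x₂‖ + ‖x₁ + x₂‖ * ‖(θ₁ : E l) - (θ₂ : E l)‖))
    -- initial data
    (hx₀ : Continuous x₀)
    -- terminal cost
    (ha : Continuous (fun q : E d × Θ => a q.1 q.2))
    (ha_nonneg : ∀ x θ, 0 ≤ a x θ)
    -- running cost
    (hf_meas : ∀ v : E k, AEMeasurable (fun t => f t v) (volume.restrict (Icc (0 : ℝ) T)))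
    (hf_conv : ∀ᵐ t ∂(volume.restrict (Icc (0 : ℝ) T)),
      Continuous (f t) ∧ ConvexOn ℝ Set.univ (f t))
    (hf_growth : ∃ (c : ℝ → ℝ) (C : ℝ), IntegrableOn c (Icc (0 : ℝ) T) ∧
      (∀ᵐ t ∂(volume.restrict (Icc (0 : ℝ) T)), 0 ≤ c t) ∧ 0 < C ∧
      ∀ᵐ t ∂(volume.restrict (Icc (0 : ℝ) T)), ∀ v : E k, C * ‖v‖ ^ p - c t ≤ f t v)
    (hf_point : ∃ (v' : E k) (c' : ℝ → ℝ), IntegrableOn c' (Icc (0 : ℝ) T) ∧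
      ∀ᵐ t ∂(volume.restrict (Icc (0 : ℝ) T)), |f t v'| ≤ c' t) :
    -- the functional is well defined: the trajectories exist and are unique on `[0,T]`,
    -- the maximum over `Θ` is attained, and the integral of the running cost makes sense
    -- in `(-∞,∞]`
    (∀ u : ControlSpace T p k,
      (∀ θ : Θ, IsTrajectory T F₀ F x₀ u θ (fun t => evolution T F₀ F x₀ u t θ) ∧
        ∀ y : ℝ → E d, IsTrajectory T F₀ F x₀ u θ y →
          EqOn y (fun t => evolution T F₀ F x₀ u t θ) (Icc (0 : ℝ) T)) ∧
      (∃ θ' : Θ, ∀ θ : Θ,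
        a (evolution T F₀ F x₀ u T θ) θ ≤ a (evolution T F₀ F x₀ u T θ') θ') ∧
      AEMeasurable (fun t => f t (u t)) (volume.restrict (Icc (0 : ℝ) T)) ∧
      (∫⁻ t in Icc (0 : ℝ) T, ENNReal.ofReal (-f t (u t))) ≠ ⊤) ∧
    -- the minimum is attained, and it is finite
    ∃ u' : ControlSpace T p k,
      minimaxCost T F₀ F x₀ a f u' = ⨅ u : ControlSpace T p k, minimaxCost T F₀ F x₀ a f u ∧
      minimaxCost T F₀ F x₀ a f u' ≠ ⊥ ∧ minimaxCost T F₀ F x₀ a f u' ≠ ⊤ := by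
  have : CompactSpace Θ := isCompact_iff_compactSpace.1 hΘ
  have : Nonempty Θ := hΘne.to_subtype
  have : Fact (1 ≤ ENNReal.ofReal p) := ⟨ENNReal.one_le_ofReal.2 hp.le⟩
  obtain ⟨L, hL, hF⟩ := hF
  have hdist (θ₁ θ₂ : Θ) : ‖(θ₁ : E l) - θ₂‖ = dist θ₁ θ₂ := (dist_eq_norm _ _).symm
  simp only [hdist] at hF
  have hF : IsEnsembleLipschitz L F₀ F :=
    ⟨hL.le, fun x₁ x₂ θ₁ θ₂ => (hF x₁ x₂ θ₁ θ₂).1, fun i x₁ x₂ θ₁ θ₂ => (hF x₁ x₂ θ₁ θ₂).2 i⟩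
  have hf : IsConvexIntegrand (volume.restrict (Icc 0 T)) f :=
    ⟨hf_meas, hf_conv.mono fun _ h => h.1, hf_conv.mono fun _ h => h.2⟩
  obtain ⟨c, C, hc, hc₀, hC, hgrowth⟩ := hf_growth
  have hfc : IsCoerciveIntegrand (volume.restrict (Icc 0 T)) p c f := ⟨hc, hc₀, C, hC, hgrowth⟩
  obtain ⟨v', c', hc', hv'⟩ := hf_point
  have hint (u : ControlSpace T p k) := intervalIntegrable_coeFn u hT.le
  have htraj (u : ControlSpace T p k) := hF.isTrajectory_evolution (x₀ := x₀) hT.le (hint u)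
  refine ⟨fun u => ⟨fun θ => ⟨htraj u θ, fun y hy => hy.eqOn hF hT.le (hint u) (htraj u θ)⟩,
    hF.exists_forall_terminalCost_le hT.le hx₀ ha (hint u), hf.aemeasurable_comp u,
    hfc.lintegral_ofReal_neg_ne_top u⟩, ?_⟩
  obtain ⟨w, hw⟩ := hF.exists_forall_minimaxCost_le (x₀ := x₀) hT.le hp
    (fun θ => ha.comp (.prodMk_left θ)) ha_nonneg hf hfc
  obtain ⟨u, hu⟩ := hF.exists_minimaxCost_ne_top (p := p) hT.le hx₀ ha hc'
    (hv'.mono fun _ ht => (le_abs_self _).trans ht)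
  exact ⟨w, le_antisymm (le_iInf hw) (iInf_le _ w), minimaxCost_ne_bot ha_nonneg hf hfc w,
    ne_top_of_le_ne_top hu (hw u)⟩
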